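/- **Conventions.** Let $d\ge1$. $\mathbb R^d$ carries the supremum norm, $|A|$ is the diameter of $A$, $B(x,r)$ is the closed ball, and $\dim$ is Hausdorff dimension. Fix an integer $c\ge2$. For $j\ge0$ and $\mathbf k\in\{0,\dots,c^j-1\}^d$ let $I_{j,\mathbf k}=\prod_{i}[k_ic^{-j},(k_i+1)c^{-j})$ (the $c$-adic boxes). For $y\in[0,1)^d$ let $\mathbf k_{j,y}$ be the index of the box of generation $j$ containing $y$. Let $x_n\in[0,1]^d$, and let $(\lambda_n)$ be a non-increasing sequence of positive reals converging to $0$. **Multinomial measure.** Given an integer $b\ge2$ and positive weights $(p_e)_{e\in\{0,\dots,b-1\}^d}$ with $\sum_e p_e=1$, the multinomial measure is the law of $\sum_{j\ge1}b^{-j}\xi_j$, where the $\xi_j$ are independent with law $(p_e)$. (For weights of product form this is a product of $d$ one-dimensional multinomial measures.) **Legendre transform.** $\tau_\mu(q)=\liminf_{j\to\infty}-\frac1j\log_c\sum_{\mathbf k}\mu(I_{j,\mathbf k})^q$ and $\tau_\mu^*(\alpha)=\inf_{q\in\mathbb R}(\alpha q-\tau_\mu(q))$. **Weak redundancy.** Let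 $T_j=\{n:2^{-(j+1)}<\lambda_n\le2^{-j}\}$. The system $\{(x_n,\lambda_n)\}$ is weakly redundant if there are integers $N_j$ with $\frac{\log N_j}{j}\to0$ such that, for every $j\ge1$, $T_j$ is a union of $N_j$ pairwise disjoint sets, along each of which the balls $B(x_n,\lambda_n)$ are pairwise disjoint. **1-heterogeneous ubiquity.** Let $\alpha>0$, $\beta\in(0,d]$, $\mathcal D\subset(1,\infty)$. The system is 1-heterogeneous ubiquitous with respect to $(\mu,\alpha,\beta)$, with exponent set $\mathcal D$, if there are functions $\varphi,\psi$, a finite Borel measure $m$ with support $[0,1]^d$ and, for every $c$-adic box $L\subset[0,1)^d$, a finite measure $m^L$ on $L$ equivalent to $m_{|L}$, such that: 1. $\varphi,\psi$ are non-decreasing and continuous on $[0,\infty)$ with $\varphi(0)=\psi(0)=0$; $r^{-\varphi(r)}$ and $r^{-\psi(r)}$ are non-increasing near $0^+$; $r^{-\varphi(r)}\to+\infty$ as $r\to0^+$; and for every $\epsilon>0$, $r^{\epsilon-\varphi(r)}$ is non-decreasing near $0^+$. 2. $m$-almost every $y$ lies in $\limsup_n B(x_n,\lambda_n/2)$. Moreover,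 for $m$-almost every $y\in[0,1)^d$, for all large $j$ and all $\mathbf k$ with $\|\mathbf k-\mathbf k_{j,y}\|_\infty\le1$, the box $I=I_{j,\mathbf k}$ satisfies $|I|^{\alpha+\psi(|I|)}\le\mu(I)\le|I|^{\alpha-\psi(|I|)}$ and $m(I)\le|I|^{\beta-\varphi(|I|)}$. 3. For every $L$, the last property, the one bounding $m(I)$, also holds with $m$ replaced throughout by $m^L\circ f_L^{-1}$, where $f_L$ is the canonical affine map from $L$ onto $[0,1)^d$. 4. Let $E_n^L$ be the set of $y\in L$ such that for all $j\ge n+\log_c(|L|^{-1})$ and all $\mathbf k$ with $\|\mathbf k-\mathbf k_{j,y}\|_\infty\le1$, $m^L(I_{j,\mathbf k})\le(|I_{j,\mathbf k}|/|L|)^{\beta-\varphi(|I_{j,\mathbf k}|/|L|)}$. Let $n_L=\inf\{n\ge1:m^L(E_n^L)\ge\|m^L\|/2\}$. Then for every $\delta\in\mathcal D$ and $m$-almost every $y\in\limsup_nB(x_n,\lambda_n/2)$, there are infinitely many $j$ for which there exist an $n$ with $y\in B(x_n,\lambda_n/2)$ and $c^{-(j+1)}<\lambda_n\le c^{-j}$,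 and a box $L$ of maximal diameter among the $c$-adic boxes of $[0,1)^d$ contained in $B(x_n,\lambda_n^\delta)$, with $n_L\le\log_c(|L|^{-1})\,\varphi(|L|)$ and $|L|^{\varphi(|L|)}\le\|m^L\|$. **Theorem.** Let $\mu$ be a multinomial measure on $[0,1]^d$, and let $\{(x_n,\lambda_n)\}$ be weakly redundant and 1-heterogeneous ubiquitous with respect to $(\mu,\alpha,\tau_\mu^*(\alpha))$, with an exponent set $\mathcal D$ that is dense in $(1,\infty)$ (for instance $\mathcal D=(1,\infty)$). Then there is a sequence $\varepsilon=(\varepsilon_n)$ of positive reals converging to $0$ such that, for every $\delta\ge1$, $$\dim S_\mu(\delta,\alpha,\varepsilon)=\frac{\tau_\mu^*(\alpha)}{\delta},\qquad S_\mu(\delta,\alpha,\varepsilon)=\bigcap_{N}\ \bigcup_{n\ge N:\ \lambda_n^{\alpha+\varepsilon_n}\le\mu(B(x_n,\lambda_n))\le\lambda_n^{\alpha-\varepsilon_n}}B(x_n,\lambda_n^\delta).$$ -/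

import Mathlib

open MeasureTheory Filter Topology Set

namespace HetUbiquity

noncomputable section

/- Throughout, `ℝ^d` is `Fin d → ℝ`, which carries the supremum norm, and `B(x, r)` is the closed
ball `Metric.closedBall x r`. -/

variable {d : ℕ}

/-! ### Multinomial measures -/

/-- The law of one digit in `{0, …, b-1}^d` with weights `p`. -/
def digitLaw {b : ℕ} (p : (Fin d → Fin b) → ℝ) : Measure (Fin d → Fin b) :=
  ∑ e, ENNReal.ofReal (p e) • Measure.dirac e

/-- The point of `[0,1]^d` whose `i`-th coordinate has the base-`b` digits `ω 0 i, ω 1 i, …`. -/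
def digitPoint {b : ℕ} (ω : ℕ → Fin d → Fin b) : Fin d → ℝ :=
  fun i => ∑' j : ℕ, ((ω j i : ℕ) : ℝ) / (b : ℝ) ^ (j + 1)

/-- The multinomial measure on `[0,1]^d` with base `b` and weights `p`: the law of the point whose
successive base-`b` digits (elements of `{0, …, b-1}^d`) are independent with law `p`. -/
def multinomialMeasure (b : ℕ) (p : (Fin d → Fin b) → ℝ) : Measure (Fin d → ℝ) :=
  (Measure.infinitePi fun _ : ℕ => digitLaw p).map digitPoint

/-! ### The `c`-adic boxes -/

/-- The side length `c^{-j}` of the `c`-adic boxes of generation `j`; for `d ≥ 1` this is their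
diameter in the supremum norm. -/
def side (c j : ℕ) : ℝ := ((c : ℝ) ^ j)⁻¹

/-- The `c`-adic box `I_{j,k} = ∏ i, [k i * c^{-j}, (k i + 1) * c^{-j})`. -/
def box (c j : ℕ) (k : Fin d → ℕ) : Set (Fin d → ℝ) :=
  {x | ∀ i, (k i : ℝ) * side c j ≤ x i ∧ x i < ((k i : ℝ) + 1) * side c j}

/-- The half-open unit cube `[0,1)^d`. -/
def unitBox (d : ℕ) : Set (Fin d → ℝ) := {x | ∀ i, 0 ≤ x i ∧ x i < 1}

/-- `k ∈ {0, …, c^j - 1}^d`, i.e. the box `I_{j,k}` lies in `[0,1)^d`. -/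
def IsIndex (c j : ℕ) (k : Fin d → ℕ) : Prop := ∀ i, k i < c ^ j

/-- The index `k_{j,y}` of the box of generation `j` containing `y ∈ [0,1)^d`. -/
def boxIndex (c j : ℕ) (y : Fin d → ℝ) : Fin d → ℕ := fun i => ⌊(c : ℝ) ^ j * y i⌋₊

/-- `‖k - k'‖_∞ ≤ 1`. -/
def Near (k k' : Fin d → ℕ) : Prop := ∀ i, k i ≤ k' i + 1 ∧ k' i ≤ k i + 1

/-- The canonical affine map from the box `I_{j,k}` onto `[0,1)^d`. -/
def boxMap (c j : ℕ) (k : Fin d → ℕ) (x : Fin d → ℝ) : Fin d → ℝ :=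
  fun i => (c : ℝ) ^ j * x i - (k i : ℝ)

/-! ### The function `τ_μ` and its Legendre transform -/

/-- `τ_{μ,c}(q) = liminf_j -(1/j) log_c ∑_{k ∈ {0,…,c^j-1}^d} μ(I_{j,k})^q`. -/
def tau (c : ℕ) (μ : Measure (Fin d → ℝ)) (q : ℝ) : EReal :=
  liminf (fun j : ℕ => ((-(1 / (j : ℝ)) * Real.logb c
    (∑ k : Fin d → Fin (c ^ j), μ.real (box c j fun i => (k i : ℕ)) ^ q) : ℝ) : EReal)) atTop

/-- `τ_μ^*(α) = inf_{q ∈ ℝ} (α q - τ_μ(q))`. -/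
def tauStar (c : ℕ) (μ : Measure (Fin d → ℝ)) (α : ℝ) : EReal :=
  ⨅ q : ℝ, ((α * q : ℝ) : EReal) - tau c μ q

/-! ### Weakly redundant systems -/

/-- `T_j = {n : 2^{-(j+1)} < λ_n ≤ 2^{-j}}`. -/
def dyadicClass (lam : ℕ → ℝ) (j : ℕ) : Set ℕ := {n | side 2 (j + 1) < lam n ∧ lam n ≤ side 2 j}

/-- Weak redundancy: for `j ≥ 1`, `T_j` splits into `N_j` pairwise disjoint sets, along each of
which the balls `B(x_n, λ_n)` are pairwise disjoint, where `log N_j / j → 0`. -/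
def IsWeaklyRedundant (x : ℕ → Fin d → ℝ) (lam : ℕ → ℝ) : Prop :=
  ∃ N : ℕ → ℕ, Tendsto (fun j : ℕ => Real.log (N j) / (j : ℝ)) atTop (𝓝 0) ∧
    ∀ j, 1 ≤ j → ∃ T : Fin (N j) → Set ℕ,
      (⋃ i, T i) = dyadicClass lam j ∧
      (∀ i i', i ≠ i' → Disjoint (T i) (T i')) ∧
      ∀ i, ∀ n ∈ T i, ∀ n' ∈ T i, n ≠ n' →
        Disjoint (Metric.closedBall (x n) (lam n)) (Metric.closedBall (x n') (lam n'))

/-! ### Heterogeneous ubiquitous systems -/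

/-- `⋂_N ⋃_{n ≥ N} B(x_n, λ_n / 2)`. -/
def limsupHalf (x : ℕ → Fin d → ℝ) (lam : ℕ → ℝ) : Set (Fin d → ℝ) :=
  {y | ∀ N : ℕ, ∃ n, N ≤ n ∧ y ∈ Metric.closedBall (x n) (lam n / 2)}

/-- For `m`-almost every `y`, for all large `j`, every box `I` of generation `j` equal or adjacent
to the one containing `y` has `|I|^{α+ψ(|I|)} ≤ μ(I) ≤ |I|^{α-ψ(|I|)}`. -/
def LocalScaling (c : ℕ) (m μ : Measure (Fin d → ℝ)) (α : ℝ) (ψ : ℝ → ℝ) : Prop :=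
  ∀ᵐ y ∂m, y ∈ unitBox d → ∃ j₀ : ℕ, ∀ j, j₀ ≤ j → ∀ k : Fin d → ℕ,
    IsIndex c j k → Near k (boxIndex c j y) →
      side c j ^ (α + ψ (side c j)) ≤ μ.real (box c j k) ∧
      μ.real (box c j k) ≤ side c j ^ (α - ψ (side c j))

/-- For `m`-almost every `y`, for all large `j`, every box `I` of generation `j` equal or adjacent
to the one containing `y` has `m(I) ≤ |I|^{β-φ(|I|)}`. -/
def LocalUpperBound (c : ℕ) (m : Measure (Fin d → ℝ)) (β : ℝ) (φ : ℝ → ℝ) : Prop :=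
  ∀ᵐ y ∂m, y ∈ unitBox d → ∃ j₀ : ℕ, ∀ j, j₀ ≤ j → ∀ k : Fin d → ℕ,
    IsIndex c j k → Near k (boxIndex c j y) →
      m.real (box c j k) ≤ side c j ^ (β - φ (side c j))

/-- The set `E_n^L` for the box `L = I_{J,K}` and the measure `mL` on `L`. -/
def growthSet (c : ℕ) (β : ℝ) (φ : ℝ → ℝ) (mL : Measure (Fin d → ℝ)) (J : ℕ) (K : Fin d → ℕ)
    (n : ℕ) : Set (Fin d → ℝ) :=
  {y | y ∈ box c J K ∧ ∀ j, n + J ≤ j → ∀ k : Fin d → ℕ,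
    IsIndex c j k → Near k (boxIndex c j y) →
      mL.real (box c j k) ≤
        (side c j / side c J) ^ (β - φ (side c j / side c J))}

/-- `n_L = inf {n ≥ 1 : m^L(E_n^L) ≥ ‖m^L‖ / 2}` for the box `L = I_{J,K}`. -/
def growthIndex (c : ℕ) (β : ℝ) (φ : ℝ → ℝ) (mL : Measure (Fin d → ℝ)) (J : ℕ)
    (K : Fin d → ℕ) : ℕ :=
  sInf {n : ℕ | 1 ≤ n ∧ mL.real univ / 2 ≤ mL.real (growthSet c β φ mL J K n)}

/-- `I_{J,K}` is one of the `c`-adic boxes of `[0,1)^d` of maximal diameter contained in `A`. -/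
def IsMaximalBox (c : ℕ) (A : Set (Fin d → ℝ)) (J : ℕ) (K : Fin d → ℕ) : Prop :=
  IsIndex c J K ∧ box c J K ⊆ A ∧
    ∀ (J' : ℕ) (K' : Fin d → ℕ), IsIndex c J' K' → box c J' K' ⊆ A → J ≤ J'

/-- Conditions on the gauges `φ` and `ψ`. -/
structure IsGaugePair (φ ψ : ℝ → ℝ) : Prop where
  monotone_phi : MonotoneOn φ (Ici 0)
  monotone_psi : MonotoneOn ψ (Ici 0)
  continuous_phi : ContinuousOn φ (Ici 0)
  continuous_psi : ContinuousOn ψ (Ici 0)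
  phi_zero : φ 0 = 0
  psi_zero : ψ 0 = 0
  antitone_phi : ∃ r₀ > 0, AntitoneOn (fun r : ℝ => r ^ (-φ r)) (Ioo 0 r₀)
  antitone_psi : ∃ r₀ > 0, AntitoneOn (fun r : ℝ => r ^ (-ψ r)) (Ioo 0 r₀)
  tendsto_phi : Tendsto (fun r : ℝ => r ^ (-φ r)) (𝓝[>] 0) atTop
  monotone_sub_phi : ∀ ε > 0, ∃ r₀ > 0, MonotoneOn (fun r : ℝ => r ^ (ε - φ r)) (Ioo 0 r₀)

/-- The system `(x_n, λ_n)` is `1`-heterogeneous ubiquitous with respect to `(μ, α, β)`, with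
gauges `φ, ψ`, auxiliary measure `m`, measures `m^L = mL J K` on the boxes `L = I_{J,K}`, and with
`D` as the set of exponents for which the growth control holds. -/
structure IsHeterogeneousUbiquitousWith (c : ℕ) (μ : Measure (Fin d → ℝ)) (α β : ℝ)
    (x : ℕ → Fin d → ℝ) (lam : ℕ → ℝ) (D : Set ℝ) (φ ψ : ℝ → ℝ) (m : Measure (Fin d → ℝ))
    (mL : ℕ → (Fin d → ℕ) → Measure (Fin d → ℝ)) : Prop where
  alpha_pos : 0 < α
  beta_pos : 0 < β
  beta_le : β ≤ d
  gauges : IsGaugePair φ ψ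
  finite_m : IsFiniteMeasure m
  support_m : m.support = Icc 0 1
  covered : ∀ᵐ y ∂m, y ∈ limsupHalf x lam
  scaling : LocalScaling c m μ α ψ
  upper : LocalUpperBound c m β φ
  /-- Self-similarity: `m^L` is equivalent to `m` restricted to `L`, and its image on `[0,1)^d`
  satisfies the same upper bound as `m`. -/
  finite_mL : ∀ J K, IsIndex c J K → IsFiniteMeasure (mL J K)
  mL_abs : ∀ J K, IsIndex c J K → mL J K ≪ m.restrict (box c J K)
  abs_mL : ∀ J K, IsIndex c J K → m.restrict (box c J K) ≪ mL J K
  upper_mL : ∀ J K, IsIndex c J K → LocalUpperBound c ((mL J K).map (boxMap c J K)) β φ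
  subset_D : D ⊆ Ioi 1
  /-- Growth control: there are infinitely many `j` with a box `L ∈ B_j^δ(y)` such that
  `n_L ≤ log_c(|L|⁻¹) φ(|L|)` and `|L|^{φ(|L|)} ≤ ‖m^L‖`; here `log_c(|L|⁻¹) = J`. -/
  growth : ∀ δ ∈ D, ∀ᵐ y ∂m, y ∈ limsupHalf x lam → ∀ j₀ : ℕ, ∃ j, j₀ ≤ j ∧ ∃ n : ℕ,
    y ∈ Metric.closedBall (x n) (lam n / 2) ∧ side c (j + 1) < lam n ∧ lam n ≤ side c j ∧
    ∃ (J : ℕ) (K : Fin d → ℕ), IsMaximalBox c (Metric.closedBall (x n) (lam n ^ δ)) J K ∧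
      (growthIndex c β φ (mL J K) J K : ℝ) ≤ J * φ (side c J) ∧
      side c J ^ φ (side c J) ≤ (mL J K).real univ

/-- The system `(x_n, λ_n)` is `1`-heterogeneous ubiquitous with respect to `(μ, α, β)`, relative
to the `c`-adic grid, with growth control for the exponents in `D`. -/
def IsHeterogeneousUbiquitous (c : ℕ) (μ : Measure (Fin d → ℝ)) (α β : ℝ)
    (x : ℕ → Fin d → ℝ) (lam : ℕ → ℝ) (D : Set ℝ) : Prop :=
  ∃ (φ ψ : ℝ → ℝ) (m : Measure (Fin d → ℝ)) (mL : ℕ → (Fin d → ℕ) → Measure (Fin d → ℝ)),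
    IsHeterogeneousUbiquitousWith c μ α β x lam D φ ψ m mL

/-! ### Conditioned limsup sets -/

/-- `S_μ(δ, α, ε)`: the points lying in infinitely many of the balls `B(x_n, λ_n^δ)` with
`λ_n^{α+ε_n} ≤ μ(B(x_n, λ_n)) ≤ λ_n^{α-ε_n}`. -/
def conditionedLimsup (μ : Measure (Fin d → ℝ)) (x : ℕ → Fin d → ℝ) (lam : ℕ → ℝ)
    (δ α : ℝ) (ε : ℕ → ℝ) : Set (Fin d → ℝ) :=
  {y | ∀ N : ℕ, ∃ n, N ≤ n ∧
    lam n ^ (α + ε n) ≤ μ.real (Metric.closedBall (x n) (lam n)) ∧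
    μ.real (Metric.closedBall (x n) (lam n)) ≤ lam n ^ (α - ε n) ∧
    y ∈ Metric.closedBall (x n) (lam n ^ δ)}

end

end HetUbiquity

/-! Write β for `tauStar c μ α`. The two inequalities are independent. The multinomial structure of
`μ` serves both through two facts: `μ` is finite, and it does not charge the complement of
`[0,1)^d`.

The errors ε come from the local scaling property (`exists_scaling_errors`). If the boxes around `y`
scale with exponent `α` up to `ψ` and `y ∈ B(x_n, λ_n/2)`, then comparing `B(x_n, λ_n)` with boxes
of comparable side gives `μ(B(x_n, λ_n))` the exponent `α` up to `ψ(2cλ_n) + O(1/|log λ_n|)`. This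
quantity depends neither on `y` nor on δ, so one sequence serves all δ. For `m`-almost every `y`,
the mass condition then holds at every sufficiently small ball whose middle half contains `y`.

Upper bound. For `t > β` choose `q` with `αq - τ(q)` close to β. A ball of radius λ with the
prescribed mass satisfies `λ^t ≤ λ^(t-e) μ(B)^q` with `e` close to `αq`. Over disjoint balls of one
dyadic class the sum of `μ(B)^q` is at most a constant times the `q`-th moment of the boxes, hence
at most about `λ^(αq-β)`; a positive power of λ remains (`exists_sum_disjoint_le`). Weak redundancy
multiplies this by a subexponential number of families, so the series of `λ_n^t` over admissible `n`
converges (`exists_summable_rpow`). The balls `B(x_n, λ_n^δ)` then cover with finite `s`-cost as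
soon as `δs > β`.

Lower bound. For `s < β/δ₁`, density of `D` provides `δ ∈ D` with `δ₁ < δ < β/s`, and a Cantor set
is built from boxes `L` with good growth of `m^L`. Inside such an `L`, at least half of the mass of
`m^L` sits where balls of radius `R` have mass about `(R/|L|)^β` below the scale `c^(-n_L)|L|`.
Almost every point there lies in some small `B(x_n, λ_n/2)`, and `B(x_n, λ_n^δ)` contains a new good
box. A Vitali selection makes these balls well separated; each new box receives mass about `λ_n^β`,
which is the power `β/δ` of its own size (`exists_subdivision`). The growth control on `n_L` and on
the mass of `m^L` makes the loss at each step a factor `|L|^(-small)`, which the gap between `s` and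
an intermediate exponent `s'` absorbs.

The passage from this step to the dimension is `le_dimH_iInter_of_subdivision`. It needs no limit
measure: if the Cantor set had zero `s`-measure, compactness would give a finite cover of a whole
level, and the Frostman bound at a deep level would contradict total mass one. -/

namespace HetUbiquity

/-! ### A mass distribution principle for nested families of balls -/

section Cantor

variable {X : Type*} [MetricSpace X]

/-- A set of vanishing `s`-dimensional Hausdorff measure is covered by open balls with
arbitrarily small `s`-dimensional cost. -/
lemma exists_ball_cover_of_hausdorffMeasure_eq_zero [MeasurableSpace X]
    [BorelSpace X] [Nonempty X] {s : ℝ} (hs : 0 < s)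
    {K : Set X} (hK : μH[s] K = 0) {e : ℝ} (he : 0 < e) :
    ∃ (x : ℕ → X) (r : ℕ → ℝ), (∀ n, 0 < r n) ∧ K ⊆ ⋃ n, Metric.ball (x n) (r n) ∧
      ∀ T : Finset ℕ, ∑ n ∈ T, r n ^ s ≤ e := by
  have h1 : (⨅ (t : ℕ → Set X) (_ : K ⊆ ⋃ n, t n) (_ : ∀ n, Metric.ediam (t n) ≤ 1),
      ∑' n, ⨆ _ : (t n).Nonempty, Metric.ediam (t n) ^ s) < ENNReal.ofReal (e / 2) := by
    refine lt_of_le_of_lt ?_ (ENNReal.ofReal_pos.2 (half_pos he))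
    rw [← hK, Measure.hausdorffMeasure_apply]
    exact le_iSup₂_of_le (1 : ENNReal) one_pos le_rfl
  simp only [iInf_lt_iff] at h1
  obtain ⟨t, hcov, hdiam, hsum⟩ := h1
  have hterm : ∀ n, (⨆ _ : (t n).Nonempty, Metric.ediam (t n) ^ s) = Metric.ediam (t n) ^ s := by
    intro n
    rcases (t n).eq_empty_or_nonempty with h | h
    · simp [h, ENNReal.zero_rpow_of_pos hs]
    · simp [h]
  simp only [hterm] at hsum
  have hfin : ∀ n, Metric.ediam (t n) ≠ ⊤ := fun n =>
    ne_top_of_le_ne_top ENNReal.one_ne_top (hdiam n)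
  -- A radius strictly above the diameter turns each piece into a subset of an open ball; the excess
  -- costs `e / 2 / 2 ^ (n + 1)` add up to at most `e / 2`.
  have hr : ∀ n, ∃ r : ℝ, Metric.diam (t n) < r ∧
      r ^ s < Metric.diam (t n) ^ s + e / 2 / 2 ^ (n + 1) := by
    intro n
    have hc : ContinuousAt (fun r : ℝ => r ^ s) (Metric.diam (t n)) :=
      Real.continuousAt_rpow_const _ _ (Or.inr hs.le)
    have h2 : ∀ᶠ r in 𝓝 (Metric.diam (t n)),
        r ^ s < Metric.diam (t n) ^ s + e / 2 / 2 ^ (n + 1) :=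
      hc.eventually_lt_const (lt_add_of_pos_right _ (by positivity))
    have h3 : ∀ᶠ r in 𝓝[>] (Metric.diam (t n)),
        r ^ s < Metric.diam (t n) ^ s + e / 2 / 2 ^ (n + 1) := nhdsWithin_le_nhds h2
    obtain ⟨r, h4, h5⟩ := (h3.and self_mem_nhdsWithin).exists
    exact ⟨r, h5, h4⟩
  choose r hr1 hr2 using hr
  have hx : ∀ n, ∃ x : X, t n ⊆ Metric.ball x (r n) := by
    intro n
    rcases (t n).eq_empty_or_nonempty with h | ⟨y, hy⟩
    · exact ⟨Classical.arbitrary X, by simp [h]⟩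
    · refine ⟨y, fun w hw => ?_⟩
      exact lt_of_le_of_lt (Metric.dist_le_diam_of_mem'  (hfin n) hw hy) (hr1 n)
  choose x hx using hx
  refine ⟨x, r, fun n => Metric.diam_nonneg.trans_lt (hr1 n),
    hcov.trans (iUnion_mono hx), fun T => ?_⟩
  have h6 : ∑ n ∈ T, Metric.diam (t n) ^ s ≤ e / 2 := by
    have h7 : ∑ n ∈ T, Metric.ediam (t n) ^ s ≤ ENNReal.ofReal (e / 2) :=
      (ENNReal.sum_le_tsum T).trans hsum.le
    have h8 : ∀ n, ENNReal.ofReal (Metric.diam (t n) ^ s) = Metric.ediam (t n) ^ s := by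
      intro n
      rw [← ENNReal.ofReal_rpow_of_nonneg Metric.diam_nonneg hs.le, Metric.diam,
        ENNReal.ofReal_toReal (hfin n)]
    simp only [← h8] at h7
    rw [← ENNReal.ofReal_sum_of_nonneg
      (fun n _ => Real.rpow_nonneg Metric.diam_nonneg s)] at h7
    exact (ENNReal.ofReal_le_ofReal_iff (by positivity)).1 h7
  have h9 : ∑ n ∈ T, e / 2 / 2 ^ (n + 1) ≤ e / 2 := by
    have h10 : HasSum (fun n : ℕ => e / 2 / 2 / 2 ^ n) (e / 2) := hasSum_geometric_two' (e / 2)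
    have h11 : ∀ n : ℕ, e / 2 / 2 ^ (n + 1) = e / 2 / 2 / 2 ^ n := by
      intro n; rw [pow_succ]; field_simp
    simp only [h11]
    exact sum_le_hasSum T (fun n _ => by positivity) h10
  calc ∑ n ∈ T, r n ^ s ≤ ∑ n ∈ T, (Metric.diam (t n) ^ s + e / 2 / 2 ^ (n + 1)) :=
        Finset.sum_le_sum fun n _ => (hr2 n).le
    _ ≤ e := by rw [Finset.sum_add_distrib]; linarith

/-- Two balls of the family are at distance more than twice the radius of the first one. -/
def Separated {ι : Type*} (z : ι → X) (ρ : ι → ℝ) (F : Finset ι) : Prop :=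
  ∀ i ∈ F, ∀ j ∈ F, i ≠ j → ∀ p ∈ Metric.closedBall (z i) (ρ i),
    ∀ q ∈ Metric.closedBall (z j) (ρ j), 2 * ρ i < dist p q

open Classical in
/-- The mass of the balls of the family that meet `B(x, r)`. -/
noncomputable def hitMass {ι : Type*} (z : ι → X) (ρ : ι → ℝ) (F : Finset ι) (v : ι → ℝ)
    (x : X) (r : ℝ) : ℝ :=
  ∑ i ∈ F with (Metric.closedBall (z i) (ρ i) ∩ Metric.closedBall x r).Nonempty, v i

/-- All balls of the family that meet `B(x, r)` have radius at most `r`. -/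
def HitsOnlySmall {ι : Type*} (z : ι → X) (ρ : ι → ℝ) (F : Finset ι) (x : X) (r : ℝ) : Prop :=
  ∀ i ∈ F, (Metric.closedBall (z i) (ρ i) ∩ Metric.closedBall x r).Nonempty → ρ i ≤ r

/-- A weighted finite family of pairwise separated good balls satisfying a Frostman bound. -/
structure IsLevel {ι : Type*} (z : ι → X) (ρ : ι → ℝ) (Good : ι → Prop) (s s' C : ℝ)
    (F : Finset ι) (w : ι → ℝ) : Prop where
  good : ∀ i ∈ F, Good i
  nonneg : ∀ i, 0 ≤ w i
  total : ∑ i ∈ F, w i = 1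
  sep : Separated z ρ F
  mass : ∀ i ∈ F, w i ≤ C * ρ i ^ s'
  frostman : ∀ x r, 0 < r → HitsOnlySmall z ρ F x r → hitMass z ρ F w x r ≤ C * r ^ s

/-- An admissible subdivision of the ball `i` into smaller good balls. -/
structure IsSubdivision {ι : Type*} (z : ι → X) (ρ : ι → ℝ) (Good : ι → Prop) (s s' : ℝ)
    (i : ι) (F : Finset ι) (v : ι → ℝ) : Prop where
  good : ∀ j ∈ F, Good j
  nonneg : ∀ j, 0 ≤ v j
  total : ∑ j ∈ F, v j = 1
  sep : Separated z ρ F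
  subset : ∀ j ∈ F, Metric.closedBall (z j) (ρ j) ⊆ Metric.closedBall (z i) (ρ i)
  radius_le : ∀ j ∈ F, ρ j ≤ ρ i
  mass : ∀ j ∈ F, v j ≤ ρ j ^ s'
  frostman : ∀ x r, 0 < r → r ≤ ρ i → HitsOnlySmall z ρ F x r →
    hitMass z ρ F v x r ≤ r ^ s / ρ i ^ s'

variable {ι : Type*} {z : ι → X} {ρ : ι → ℝ} {Good : ι → Prop} {s s' C : ℝ}

open Classical in
/-- Subdividing each ball of a level gives a level. -/
lemma IsLevel.subdivide (hρ : ∀ i, Good i → 0 < ρ i) (hC : 1 ≤ C)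
    {F : Finset ι} {w : ι → ℝ} (h : IsLevel z ρ Good s s' C F w)
    {G : ι → Finset ι} {v : ι → ι → ℝ}
    (hG : ∀ i ∈ F, IsSubdivision z ρ Good s s' i (G i) (v i)) :
    IsLevel z ρ Good s s' C (F.biUnion G)
      (fun j => ∑ i ∈ F, w i * if j ∈ G i then v i j else 0) := by
  have hnn : ∀ j, ∀ i ∈ F, 0 ≤ if j ∈ G i then v i j else 0 := by
    intro j i hi
    split_ifs
    · exact (hG i hi).nonneg j
    · exact le_rfl
  -- Masses at the new level are averages of the masses in the subdivisions. This gives the total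
  -- (`P` trivial) and the hit mass (`P` = meeting the ball).
  have key : ∀ P : ι → Prop, ∑ j ∈ F.biUnion G with P j,
      (∑ i ∈ F, w i * if j ∈ G i then v i j else 0) =
      ∑ i ∈ F, w i * ∑ j ∈ G i with P j, v i j := by
    intro P
    rw [Finset.sum_comm]
    refine Finset.sum_congr rfl fun i hi => ?_
    rw [← Finset.mul_sum, ← Finset.sum_filter]
    congr 1
    refine Finset.sum_congr ?_ fun _ _ => rfl
    ext j
    simp only [Finset.mem_filter, Finset.mem_biUnion]
    exact ⟨fun hj => ⟨hj.2, hj.1.2⟩, fun hj => ⟨⟨⟨i, hi, hj.1⟩, hj.2⟩, hj.1⟩⟩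
  refine ⟨?_, ?_, ?_, ?_, ?_, ?_⟩
  · intro j hj
    obtain ⟨i, hi, hj⟩ := Finset.mem_biUnion.1 hj
    exact (hG i hi).good j hj
  · exact fun j => Finset.sum_nonneg fun i hi => mul_nonneg (h.nonneg i) (hnn j i hi)
  · have := key fun _ => True
    simp only [Finset.filter_true] at this
    rw [this, ← h.total]
    exact Finset.sum_congr rfl fun i hi => by rw [(hG i hi).total, mul_one]
  · intro i' hi' j' hj' hne p hp q hq
    obtain ⟨i, hi, hi'⟩ := Finset.mem_biUnion.1 hi'
    obtain ⟨j, hj, hj'⟩ := Finset.mem_biUnion.1 hj'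
    by_cases hij : i = j
    · subst hij
      exact (hG i hi).sep i' hi' j' hj' hne p hp q hq
    · have h1 := h.sep i hi j hj hij p ((hG i hi).subset i' hi' hp) q ((hG j hj).subset j' hj' hq)
      have h2 := (hG i hi).radius_le i' hi'
      linarith
  · intro j hj
    obtain ⟨i₀, hi₀, hj₀⟩ := Finset.mem_biUnion.1 hj
    have hpos : 0 < ρ j := hρ j ((hG i₀ hi₀).good j hj₀)
    have hpos' : 0 ≤ ρ j ^ s' := Real.rpow_nonneg hpos.le _
    -- The new weight of `j` is an average of numbers at most `ρ j ^ s'`, so the bound does not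
    -- depend on how many parents share `j`.
    calc (∑ i ∈ F, w i * if j ∈ G i then v i j else 0) ≤ ∑ i ∈ F, w i * ρ j ^ s' := by
          refine Finset.sum_le_sum fun i hi => mul_le_mul_of_nonneg_left ?_ (h.nonneg i)
          split_ifs with hji
          · exact (hG i hi).mass j hji
          · exact hpos'
      _ = ρ j ^ s' := by rw [← Finset.sum_mul, h.total, one_mul]
      _ ≤ C * ρ j ^ s' := le_mul_of_one_le_left hpos' hC
  · intro x r hr hsmall
    have hle : ∀ i ∈ F, hitMass z ρ (G i) (v i) x r ≤
        if (Metric.closedBall (z i) (ρ i) ∩ Metric.closedBall x r).Nonempty then 1 else 0 := by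
      intro i hi
      split_ifs with hm
      · rw [← (hG i hi).total]
        exact Finset.sum_le_sum_of_subset_of_nonneg (Finset.filter_subset _ _)
          fun j _ _ => (hG i hi).nonneg j
      · refine (Finset.sum_eq_zero fun j hj => ?_).le
        obtain ⟨hj, q, hq1, hq2⟩ := Finset.mem_filter.1 hj
        exact (hm ⟨q, (hG i hi).subset j hj hq1, hq2⟩).elim
    have heq : hitMass z ρ (F.biUnion G)
        (fun j => ∑ i ∈ F, w i * if j ∈ G i then v i j else 0) x r =
        ∑ i ∈ F, w i * hitMass z ρ (G i) (v i) x r := key _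
    rw [heq]
    by_cases hbig : HitsOnlySmall z ρ F x r
    · refine le_trans ?_ (h.frostman x r hr hbig)
      rw [hitMass, Finset.sum_filter]
      refine Finset.sum_le_sum fun i hi => ?_
      refine (mul_le_mul_of_nonneg_left (hle i hi) (h.nonneg i)).trans ?_
      split_ifs <;> simp
    -- Some parent of radius larger than `r` is hit. Two points of `B(x, r)` are at most `2r` apart,
    -- so separation forbids hitting any other parent. The parent's mass bound and its internal
    -- Frostman bound multiply, and `ρ i₀ ^ s'` cancels.
    · unfold HitsOnlySmall at hbig
      push Not at hbig
      obtain ⟨i₀, hi₀, ⟨q₀, hq₀, hq₀'⟩, hlt⟩ := hbig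
      have hpos := hρ i₀ (h.good i₀ hi₀)
      have hsingle : ∑ i ∈ F, w i * hitMass z ρ (G i) (v i) x r =
          w i₀ * hitMass z ρ (G i₀) (v i₀) x r := by
        refine Finset.sum_eq_single_of_mem i₀ hi₀ fun i hi hne => ?_
        have hnot : ¬ (Metric.closedBall (z i) (ρ i) ∩ Metric.closedBall x r).Nonempty := by
          rintro ⟨q, hq, hq'⟩
          have h1 := h.sep i₀ hi₀ i hi hne.symm q₀ hq₀ q hq
          have h2 := dist_triangle_right q₀ q x
          have h3 := Metric.mem_closedBall.1 hq₀'
          have h4 := Metric.mem_closedBall.1 hq'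
          linarith
        have h5 := hle i hi
        rw [if_neg hnot] at h5
        have h6 : 0 ≤ hitMass z ρ (G i) (v i) x r :=
          Finset.sum_nonneg fun j _ => (hG i hi).nonneg j
        rw [le_antisymm h5 h6, mul_zero]
      rw [hsingle]
      have hsm : HitsOnlySmall z ρ (G i₀) x r := fun j hj =>
        hsmall j (Finset.mem_biUnion.2 ⟨i₀, hi₀, hj⟩)
      have h7 := (hG i₀ hi₀).frostman x r hr hlt.le hsm
      have h8 : 0 < ρ i₀ ^ s' := Real.rpow_pos_of_pos hpos _
      have h9 : 0 ≤ r ^ s / ρ i₀ ^ s' := div_nonneg (Real.rpow_nonneg hr.le _) h8.le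
      calc w i₀ * hitMass z ρ (G i₀) (v i₀) x r ≤ w i₀ * (r ^ s / ρ i₀ ^ s') :=
            mul_le_mul_of_nonneg_left h7 (h.nonneg i₀)
        _ ≤ C * ρ i₀ ^ s' * (r ^ s / ρ i₀ ^ s') := mul_le_mul_of_nonneg_right (h.mass i₀ hi₀) h9
        _ = C * r ^ s := by field_simp

/-- If every good ball admits, for each `N`, an admissible subdivision into good balls of radius
less than `1 / (N + 1)` contained in `A N`, then `⋂ N, A N` has dimension at least `s`. -/
theorem le_dimH_iInter_of_subdivision [MeasurableSpace X] [BorelSpace X]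
    [ProperSpace X] (hs : 0 < s)
    (hρ : ∀ i, Good i → 0 < ρ i) (A : ℕ → Set X)
    (step : ∀ (N : ℕ) i, Good i → ∃ F v, IsSubdivision z ρ Good s s' i F v ∧
      ∀ j ∈ F, ρ j < 1 / ((N : ℝ) + 1) ∧ Metric.closedBall (z j) (ρ j) ⊆ A N)
    {i₀ : ι} (hi₀ : Good i₀) : ENNReal.ofReal s ≤ dimH (⋂ N, A N) := by
  classical
  have hρ₀ := hρ i₀ hi₀
  -- Large enough for the single ball `i₀` with weight one to be a level.
  set C : ℝ := max 1 (max ((ρ i₀ ^ s)⁻¹) ((ρ i₀ ^ s')⁻¹)) with hCdef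
  have hC : 1 ≤ C := le_max_left _ _
  have hC0 : 0 < C := one_pos.trans_le hC
  have hC1 : 1 ≤ C * ρ i₀ ^ s := by
    have h1 : 0 < ρ i₀ ^ s := Real.rpow_pos_of_pos hρ₀ _
    rw [← inv_mul_cancel₀ h1.ne']
    exact mul_le_mul_of_nonneg_right ((le_max_left _ _).trans (le_max_right _ _)) h1.le
  have hC2 : 1 ≤ C * ρ i₀ ^ s' := by
    have h1 : 0 < ρ i₀ ^ s' := Real.rpow_pos_of_pos hρ₀ _
    rw [← inv_mul_cancel₀ h1.ne']
    exact mul_le_mul_of_nonneg_right ((le_max_right _ _).trans (le_max_right _ _)) h1.le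
  let L := {Fw : Finset ι × (ι → ℝ) // IsLevel z ρ Good s s' C Fw.1 Fw.2}
  have hstart : IsLevel z ρ Good s s' C {i₀} (fun _ => 1) := by
    refine ⟨by simpa using hi₀, fun _ => zero_le_one, by simp, ?_, by simpa using hC2, ?_⟩
    · intro i hi j hj hne
      rw [Finset.mem_singleton] at hi hj
      exact (hne (hi.trans hj.symm)).elim
    · intro x r hr hsm
      by_cases hm : (Metric.closedBall (z i₀) (ρ i₀) ∩ Metric.closedBall x r).Nonempty
      · have h1 := hsm i₀ (by simp) hm
        have h2 : hitMass z ρ {i₀} (fun _ => (1 : ℝ)) x r = 1 := by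
          simp [hitMass, Finset.filter_singleton, hm]
        rw [h2]
        refine hC1.trans (mul_le_mul_of_nonneg_left ?_ hC0.le)
        exact Real.rpow_le_rpow hρ₀.le h1 hs.le
      · have h2 : hitMass z ρ {i₀} (fun _ => (1 : ℝ)) x r = 0 := by
          simp [hitMass, Finset.filter_singleton, hm]
        rw [h2]
        exact mul_nonneg hC0.le (Real.rpow_nonneg hr.le _)
  let B : L → Set X := fun l => ⋃ i ∈ l.1.1, Metric.closedBall (z i) (ρ i)
  have hnext : ∀ (N : ℕ) (l : L), ∃ l' : L, B l' ⊆ B l ∧ B l' ⊆ A N ∧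
      ∀ i ∈ l'.1.1, ρ i < 1 / ((N : ℝ) + 1) := by
    rintro N ⟨⟨F, w⟩, hl⟩
    have hch : ∀ i, ∃ G v, i ∈ F → (IsSubdivision z ρ Good s s' i G v ∧
        ∀ j ∈ G, ρ j < 1 / ((N : ℝ) + 1) ∧ Metric.closedBall (z j) (ρ j) ⊆ A N) := by
      intro i
      by_cases hi : i ∈ F
      · obtain ⟨G, v, h⟩ := step N i (hl.good i hi)
        exact ⟨G, v, fun _ => h⟩
      · exact ⟨∅, 0, fun h => (hi h).elim⟩
    choose G v hGv using hch
    refine ⟨⟨⟨F.biUnion G, _⟩, hl.subdivide hρ hC fun i hi => (hGv i hi).1⟩, ?_, ?_, ?_⟩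
    · intro y hy
      simp only [B, mem_iUnion, Finset.mem_biUnion] at hy ⊢
      obtain ⟨j, ⟨i, hi, hj⟩, hy⟩ := hy
      exact ⟨i, hi, (hGv i hi).1.subset j hj hy⟩
    · intro y hy
      simp only [B, mem_iUnion, Finset.mem_biUnion] at hy
      obtain ⟨j, ⟨i, hi, hj⟩, hy⟩ := hy
      exact ((hGv i hi).2 j hj).2 hy
    · intro j hj
      obtain ⟨i, hi, hj⟩ := Finset.mem_biUnion.1 hj
      exact ((hGv i hi).2 j hj).1
  choose nxt hn1 hn2 hn3 using hnext
  let lev : ℕ → L := fun n => Nat.rec ⟨⟨{i₀}, fun _ => 1⟩, hstart⟩ (fun k l => nxt k l) n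
  have hlev : ∀ n, lev (n + 1) = nxt n (lev n) := fun n => rfl
  set K : Set X := ⋂ n, B (lev n) with hK
  have hanti : Antitone fun n => B (lev n) := antitone_nat_of_succ_le fun n => by
    change B (lev (n + 1)) ⊆ B (lev n)
    rw [hlev]; exact hn1 n _
  have hcpt : ∀ n, IsCompact (B (lev n)) := fun n =>
    (lev n).1.1.isCompact_biUnion fun i _ => isCompact_closedBall _ _
  have hKA : K ⊆ ⋂ N, A N := fun y hy => mem_iInter.2 fun N => by
    have h1 := mem_iInter.1 hy (N + 1)
    rw [hlev] at h1
    exact hn2 N _ h1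
  refine le_trans ?_ (dimH_mono hKA)
  have hne : Nonempty X := ⟨z i₀⟩
  refine le_dimH_of_hausdorffMeasure_ne_zero (d := s.toNNReal) fun h0 => ?_
  rw [Real.coe_toNNReal s hs.le] at h0
  -- The cost `1 / (2C)` is chosen so that the Frostman bound leaves the cover with mass at most
  -- 1/2.
  obtain ⟨x, r, hr, hcov, hsum⟩ := exists_ball_cover_of_hausdorffMeasure_eq_zero hs h0
    (e := 1 / (2 * C)) (by positivity)
  have hopen : IsOpen (⋃ n, Metric.ball (x n) (r n)) := isOpen_iUnion fun n => Metric.isOpen_ball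
  obtain ⟨N₀, hN₀⟩ := exists_subset_nhds_of_isCompact (V := fun n => B (lev n))
    (directed_of_isDirected_le hanti) hcpt
    (U := ⋃ n, Metric.ball (x n) (r n)) fun y hy => hopen.mem_nhds (hcov hy)
  obtain ⟨T, hT⟩ := (hcpt N₀).elim_finite_subcover _ (fun n => Metric.isOpen_ball) hN₀
  obtain ⟨δ, hδ, hδr⟩ : ∃ δ > 0, ∀ n ∈ T, δ ≤ r n := by
    rcases T.eq_empty_or_nonempty with h | h
    · exact ⟨1, one_pos, by simp [h]⟩
    · obtain ⟨n, hn, hmin⟩ := T.exists_min_image r h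
      exact ⟨r n, hr n, hmin⟩
  obtain ⟨N₁, hN₁⟩ := exists_nat_one_div_lt hδ
  -- Level `M` is still inside the finite cover, and its radii are below every radius of that cover,
  -- so `HitsOnlySmall` holds for each covering ball.
  set M := max N₀ N₁ + 1 with hM
  have hMr : ∀ i ∈ (lev M).1.1, ρ i < δ := by
    intro i hi
    have h1 : ρ i < 1 / ((max N₀ N₁ : ℕ) + 1 : ℝ) := by
      rw [hM, hlev] at hi; exact hn3 _ _ i hi
    refine h1.trans_le (le_trans ?_ hN₁.le)
    apply one_div_le_one_div_of_le (by positivity)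
    have : (N₁ : ℝ) ≤ (max N₀ N₁ : ℕ) := by exact_mod_cast le_max_right _ _
    linarith
  have hlv := (lev M).2
  set F := (lev M).1.1
  set w := (lev M).1.2
  have hcovM : B (lev M) ⊆ ⋃ n ∈ T, Metric.ball (x n) (r n) :=
    (hanti ((le_max_left N₀ N₁).trans (Nat.le_succ _))).trans hT
  have h1 : (1 : ℝ) ≤ ∑ n ∈ T, hitMass z ρ F w (x n) (r n) := by
    rw [← hlv.total]
    simp only [hitMass, Finset.sum_filter]
    rw [Finset.sum_comm]
    refine Finset.sum_le_sum fun i hi => ?_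
    have hzi : z i ∈ B (lev M) := by
      simp only [B, mem_iUnion]
      exact ⟨i, hi, Metric.mem_closedBall_self (hρ i (hlv.good i hi)).le⟩
    obtain ⟨n, hn, hzn⟩ := mem_iUnion₂.1 (hcovM hzi)
    have hm : (Metric.closedBall (z i) (ρ i) ∩ Metric.closedBall (x n) (r n)).Nonempty :=
      ⟨z i, Metric.mem_closedBall_self (hρ i (hlv.good i hi)).le, Metric.ball_subset_closedBall hzn⟩
    refine le_trans ?_ (Finset.single_le_sum (f := fun n => if
      (Metric.closedBall (z i) (ρ i) ∩ Metric.closedBall (x n) (r n)).Nonempty then w i else 0)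
      (fun n _ => ?_) hn)
    · simp only [if_pos hm]; exact le_rfl
    · split_ifs
      · exact hlv.nonneg i
      · exact le_rfl
  have h2 : ∑ n ∈ T, hitMass z ρ F w (x n) (r n) ≤ ∑ n ∈ T, C * r n ^ s :=
    Finset.sum_le_sum fun n hn => hlv.frostman (x n) (r n) (hr n) fun i hi _ =>
      (hMr i hi).le.trans (hδr n hn)
  rw [← Finset.mul_sum] at h2
  have h3 := mul_le_mul_of_nonneg_left (hsum T) hC0.le
  have h4 : C * (1 / (2 * C)) = 1 / 2 := by field_simp
  linarith

end Cantor
/-! ### Geometry of the `c`-adic boxes -/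

section Boxes

variable {d : ℕ} {c : ℕ}

lemma side_pos (hc : 2 ≤ c) (j : ℕ) : 0 < side c j := by
  have : (0 : ℝ) < c := by exact_mod_cast (by omega : 0 < c)
  unfold side; positivity

lemma side_zero : side c 0 = 1 := by simp [side]

lemma side_add (i j : ℕ) : side c (i + j) = side c i * side c j := by
  simp [side, pow_add, mul_comm]

lemma side_succ (hc : 2 ≤ c) (j : ℕ) : (c : ℝ) * side c (j + 1) = side c j := by
  have : (0 : ℝ) < c := by exact_mod_cast (by omega : 0 < c)
  simp only [side, pow_succ]; field_simp

lemma side_antitone (hc : 2 ≤ c) : Antitone (side c) := by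
  have : (1 : ℝ) ≤ c := by exact_mod_cast (by omega : 1 ≤ c)
  intro i j hij
  exact inv_anti₀ (by positivity) (pow_le_pow_right₀ this hij)

lemma side_le_one (hc : 2 ≤ c) (j : ℕ) : side c j ≤ 1 := by
  rw [← side_zero (c := c)]; exact side_antitone hc (Nat.zero_le j)

lemma pow_mul_side (hc : 2 ≤ c) (j : ℕ) : (c : ℝ) ^ j * side c j = 1 := by
  have : (0 : ℝ) < c := by exact_mod_cast (by omega : 0 < c)
  unfold side; field_simp

lemma tendsto_side (hc : 2 ≤ c) : Tendsto (side c) atTop (𝓝 0) := by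
  have : (1 : ℝ) < c := by exact_mod_cast (by omega : 1 < c)
  exact tendsto_inv_atTop_zero.comp (tendsto_pow_atTop_atTop_of_one_lt this)

lemma exists_side_near (hc : 2 ≤ c) {r : ℝ} (h0 : 0 < r) (h1 : r ≤ 1) :
    ∃ j, side c (j + 1) < r ∧ r ≤ side c j := by
  have hc' : (1 : ℝ) < c := by exact_mod_cast (by omega : 1 < c)
  obtain ⟨n, h2, h3⟩ := exists_nat_pow_near_of_lt_one h0 h1
    (y := (c : ℝ)⁻¹) (by positivity) (inv_lt_one_of_one_lt₀ hc')
  exact ⟨n, by simpa [side] using h2, by simpa [side] using h3⟩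

lemma boxIndex_le (hc : 2 ≤ c) (j : ℕ) {y : Fin d → ℝ} {i : Fin d} (hy : 0 ≤ y i) :
    (boxIndex c j y i : ℝ) * side c j ≤ y i := by
  have h1 : ((boxIndex c j y i : ℕ) : ℝ) ≤ (c : ℝ) ^ j * y i := Nat.floor_le (by positivity)
  calc (boxIndex c j y i : ℝ) * side c j ≤ ((c : ℝ) ^ j * y i) * side c j :=
        mul_le_mul_of_nonneg_right h1 (side_pos hc j).le
    _ = ((c : ℝ) ^ j * side c j) * y i := by ring
    _ = y i := by rw [pow_mul_side hc, one_mul]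

lemma lt_boxIndex (hc : 2 ≤ c) (j : ℕ) (y : Fin d → ℝ) (i : Fin d) :
    y i < ((boxIndex c j y i : ℝ) + 1) * side c j := by
  have h1 : (c : ℝ) ^ j * y i < (boxIndex c j y i : ℝ) + 1 := Nat.lt_floor_add_one _
  calc y i = ((c : ℝ) ^ j * side c j) * y i := by rw [pow_mul_side hc, one_mul]
    _ = ((c : ℝ) ^ j * y i) * side c j := by ring
    _ < _ := mul_lt_mul_of_pos_right h1 (side_pos hc j)

lemma mem_box_boxIndex (hc : 2 ≤ c) (j : ℕ) {y : Fin d → ℝ} (hy : y ∈ unitBox d) :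
    y ∈ box c j (boxIndex c j y) :=
  fun i => ⟨boxIndex_le hc j (hy i).1, lt_boxIndex hc j y i⟩

lemma isIndex_boxIndex (hc : 2 ≤ c) (j : ℕ) {y : Fin d → ℝ} (hy : y ∈ unitBox d) :
    IsIndex c j (boxIndex c j y) := by
  intro i
  have h1 := boxIndex_le hc j (hy i).1
  have h2 := (hy i).2
  have h3 : (boxIndex c j y i : ℝ) < (c : ℝ) ^ j := by
    have h4 := pow_mul_side hc j
    by_contra hcon
    push Not at hcon
    have := mul_le_mul_of_nonneg_right hcon (side_pos hc j).le
    linarith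
  exact_mod_cast h3

lemma box_subset_unitBox (hc : 2 ≤ c) {j : ℕ} {k : Fin d → ℕ} (hk : IsIndex c j k) :
    box c j k ⊆ unitBox d := by
  intro y hy i
  obtain ⟨h1, h2⟩ := hy i
  refine ⟨le_trans (mul_nonneg (Nat.cast_nonneg _) (side_pos hc j).le) h1, h2.trans_le ?_⟩
  have h3 : ((k i : ℝ) + 1) ≤ (c : ℝ) ^ j := by exact_mod_cast hk i
  calc ((k i : ℝ) + 1) * side c j ≤ (c : ℝ) ^ j * side c j :=
        mul_le_mul_of_nonneg_right h3 (side_pos hc j).le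
    _ = 1 := pow_mul_side hc j

lemma near_refl (k : Fin d → ℕ) : Near k k := fun _ => ⟨Nat.le_succ _, Nat.le_succ _⟩

/-- Non-strict upper inequalities allow `y` on the upper faces, as happens for centres in the closed
cube. -/
lemma box_subset_closedBall (hc : 2 ≤ c) {j : ℕ} {k : Fin d → ℕ} {y : Fin d → ℝ}
    (hy : ∀ i, (k i : ℝ) * side c j ≤ y i ∧ y i ≤ ((k i : ℝ) + 1) * side c j) :
    box c j k ⊆ Metric.closedBall y (side c j) := by
  intro w hw
  rw [Metric.mem_closedBall, dist_pi_le_iff (side_pos hc j).le]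
  intro i
  obtain ⟨h1, h2⟩ := hw i
  obtain ⟨h3, h4⟩ := hy i
  rw [Real.dist_eq, abs_le]
  constructor <;> linarith

lemma box_subset_closedBall_of_mem (hc : 2 ≤ c) {j : ℕ} {k : Fin d → ℕ} {y : Fin d → ℝ}
    (hy : y ∈ box c j k) : box c j k ⊆ Metric.closedBall y (side c j) :=
  box_subset_closedBall hc fun i => ⟨(hy i).1, (hy i).2.le⟩

/-- The lower corner of the box `I_{j,k}`. -/
noncomputable def corner (c j : ℕ) (k : Fin d → ℕ) : Fin d → ℝ := fun i => (k i : ℝ) * side c j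

lemma corner_mem_box (hc : 2 ≤ c) (j : ℕ) (k : Fin d → ℕ) : corner c j k ∈ box c j k := by
  intro i
  have := side_pos hc j
  simp only [corner]
  exact ⟨le_rfl, by linarith⟩

/-- A ball centred in the closed unit cube contains a box of any generation with side at most its
radius. -/
lemma exists_box_subset_closedBall (hc : 2 ≤ c) {x : Fin d → ℝ} (hx : x ∈ Icc (0 : Fin d → ℝ) 1)
    {j : ℕ} {r : ℝ} (hr : side c j ≤ r) :
    ∃ k : Fin d → ℕ, IsIndex c j k ∧ box c j k ⊆ Metric.closedBall x r ∧
      ∀ i, (k i : ℝ) * side c j ≤ x i ∧ x i ≤ ((k i : ℝ) + 1) * side c j := by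
  have hs := side_pos hc j
  have hcj : 1 ≤ c ^ j := Nat.one_le_pow _ _ (by omega)
  -- A coordinate equal to 1 has floor `c ^ j`, which is not an admissible index; truncation at `c ^
  -- j - 1` selects the last box, whose closure contains it.
  have key : ∀ i, (min (boxIndex c j x i) (c ^ j - 1) : ℕ) * side c j ≤ x i ∧
      x i ≤ ((min (boxIndex c j x i) (c ^ j - 1) : ℕ) + 1 : ℝ) * side c j := by
    intro i
    have h1 := boxIndex_le hc j (hx.1 i)
    have h2 := lt_boxIndex hc j x i
    have h3 : x i ≤ 1 := hx.2 i
    constructor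
    · refine le_trans (mul_le_mul_of_nonneg_right ?_ hs.le) h1
      exact_mod_cast min_le_left _ _
    · rcases le_total (boxIndex c j x i) (c ^ j - 1) with h | h
      · rw [min_eq_left h]; exact h2.le
      · rw [min_eq_right h, Nat.cast_sub hcj]
        push_cast
        rw [sub_add_cancel, pow_mul_side hc]
        exact h3
  refine ⟨fun i => min (boxIndex c j x i) (c ^ j - 1), fun i => ?_, ?_, key⟩
  · exact lt_of_le_of_lt (min_le_right _ _) (by omega)
  · exact (box_subset_closedBall hc key).trans (Metric.closedBall_subset_closedBall hr)

/-- The multi-indices at distance at most `A` from `l`. -/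
def indexBall (A : ℕ) (l : Fin d → ℕ) : Finset (Fin d → ℕ) :=
  Fintype.piFinset fun i => Finset.Icc (l i - A) (l i + A)

lemma mem_indexBall {A : ℕ} {k l : Fin d → ℕ} :
    k ∈ indexBall A l ↔ ∀ i, k i ≤ l i + A ∧ l i ≤ k i + A := by
  simp only [indexBall, Fintype.mem_piFinset, Finset.mem_Icc]
  exact forall_congr' fun i => by omega

lemma card_indexBall_le (A : ℕ) (l : Fin d → ℕ) : (indexBall A l).card ≤ (2 * A + 1) ^ d := by
  rw [indexBall, Fintype.card_piFinset]
  refine (Finset.prod_le_pow_card _ _ (2 * A + 1) fun i _ => ?_).trans (by simp)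
  rw [Nat.card_Icc]; omega

/-- The multi-indices of the boxes of generation `j` contained in the unit cube. -/
def gridIndices (d c j : ℕ) : Finset (Fin d → ℕ) :=
  Fintype.piFinset fun _ => Finset.range (c ^ j)

lemma mem_gridIndices {j : ℕ} {k : Fin d → ℕ} : k ∈ gridIndices d c j ↔ IsIndex c j k := by
  simp [gridIndices, IsIndex]

lemma sum_gridIndices {j : ℕ} (f : (Fin d → ℕ) → ℝ) :
    ∑ k : Fin d → Fin (c ^ j), f (fun i => (k i : ℕ)) = ∑ k ∈ gridIndices d c j, f k := by
  refine Finset.sum_bij (fun k _ => fun i => (k i : ℕ)) ?_ ?_ ?_ ?_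
  · intro k _
    exact mem_gridIndices.2 fun i => (k i).2
  · intro k _ k' _ h
    funext i
    exact Fin.ext (congrFun h i)
  · intro k hk
    exact ⟨fun i => ⟨k i, mem_gridIndices.1 hk i⟩, Finset.mem_univ _, rfl⟩
  · intro k _; rfl

/-- Points at distance at most `A` times the side lie in boxes with indices at distance at
most `A`. -/
lemma boxIndex_mem_indexBall (hc : 2 ≤ c) {j A : ℕ} {x y : Fin d → ℝ} (hx : ∀ i, 0 ≤ x i)
    (hy : ∀ i, 0 ≤ y i) (h : dist y x ≤ A * side c j) :
    boxIndex c j y ∈ indexBall A (boxIndex c j x) := by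
  have hcj : (0 : ℝ) ≤ (c : ℝ) ^ j := by positivity
  have h4 := pow_mul_side hc j
  have aux : ∀ {a b : ℝ}, 0 ≤ a → 0 ≤ b → a ≤ b + A * side c j →
      ⌊(c : ℝ) ^ j * a⌋₊ ≤ ⌊(c : ℝ) ^ j * b⌋₊ + A := by
    intro a b ha hb hab
    rw [← Nat.floor_add_natCast (by positivity)]
    refine Nat.floor_le_floor ?_
    calc (c : ℝ) ^ j * a ≤ (c : ℝ) ^ j * (b + A * side c j) := mul_le_mul_of_nonneg_left hab hcj
      _ = (c : ℝ) ^ j * b + A * ((c : ℝ) ^ j * side c j) := by ring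
      _ = _ := by rw [h4, mul_one]
  rw [mem_indexBall]
  intro i
  have h5 := (dist_le_pi_dist y x i).trans h
  rw [Real.dist_eq, abs_le] at h5
  exact ⟨aux (hy i) (hx i) (by linarith), aux (hx i) (hy i) (by linarith)⟩

/-- The measure of a ball is bounded by the sum of the measures of the neighbouring boxes. -/
lemma measureReal_closedBall_le_sum (hc : 2 ≤ c) {μ : Measure (Fin d → ℝ)} [IsFiniteMeasure μ]
    (hμ : μ (unitBox d)ᶜ = 0) {j A : ℕ} {x : Fin d → ℝ} (hx : ∀ i, 0 ≤ x i) {r : ℝ}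
    (hr : r ≤ A * side c j) :
    μ.real (Metric.closedBall x r) ≤
      ∑ k ∈ gridIndices d c j with k ∈ indexBall A (boxIndex c j x), μ.real (box c j k) := by
  have h1 : Metric.closedBall x r ⊆ (unitBox d)ᶜ ∪
      ⋃ k ∈ (gridIndices d c j).filter (· ∈ indexBall A (boxIndex c j x)), box c j k := by
    intro w hw
    by_cases hwu : w ∈ unitBox d
    · right
      simp only [mem_iUnion, Finset.mem_filter]
      exact ⟨boxIndex c j w, ⟨mem_gridIndices.2 (isIndex_boxIndex hc j hwu),
        boxIndex_mem_indexBall hc hx (fun i => (hwu i).1) (hw.trans hr)⟩, mem_box_boxIndex hc j hwu⟩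
    · exact Or.inl hwu
  refine (measureReal_mono h1).trans ((measureReal_union_le _ _).trans ?_)
  rw [measureReal_def, hμ, ENNReal.toReal_zero, zero_add]
  exact measureReal_biUnion_finset_le _ _

/-- A ball of radius at most the side meets, inside the cube, only the box of its centre and the
adjacent ones, at most `3 ^ d` in number. -/
lemma measureReal_closedBall_le_of_near (hc : 2 ≤ c) {μ : Measure (Fin d → ℝ)} [IsFiniteMeasure μ]
    (hμ : μ (unitBox d)ᶜ = 0) {j : ℕ} {x : Fin d → ℝ} (hx : ∀ i, 0 ≤ x i) {r b : ℝ}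
    (hr : r ≤ side c j) (hb0 : 0 ≤ b)
    (hb : ∀ k, IsIndex c j k → Near k (boxIndex c j x) → μ.real (box c j k) ≤ b) :
    μ.real (Metric.closedBall x r) ≤ 3 ^ d * b := by
  refine (measureReal_closedBall_le_sum hc hμ (A := 1) hx (by simpa using hr)).trans ?_
  refine (Finset.sum_le_card_nsmul _ _ b fun k hk => ?_).trans ?_
  · obtain ⟨h1, h2⟩ := Finset.mem_filter.1 hk
    exact hb k (mem_gridIndices.1 h1) (mem_indexBall.1 h2)
  · rw [nsmul_eq_mul]
    refine mul_le_mul_of_nonneg_right ?_ hb0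
    have h1 : ((gridIndices d c j).filter (· ∈ indexBall 1 (boxIndex c j x))).card ≤ 3 ^ d :=
      (Finset.card_le_card fun k hk => (Finset.mem_filter.1 hk).2).trans (card_indexBall_le 1 _)
    exact_mod_cast h1

/-- A box contained in a ball has side at most twice the radius. -/
lemma side_le_of_box_subset (hc : 2 ≤ c) (hd : 0 < d) {J : ℕ} {K : Fin d → ℕ} {x : Fin d → ℝ}
    {r : ℝ} (h : box c J K ⊆ Metric.closedBall x r) : side c J ≤ 2 * r := by
  -- The half-open box does not attain its diameter, so every `t` below the side is tested with the
  -- corner and its diagonal translate by `t`.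
  refine le_of_forall_lt_imp_le_of_dense fun t ht => ?_
  rcases lt_or_ge t 0 with h0 | h0
  · have := Metric.mem_closedBall.1 (h (corner_mem_box hc J K))
    have := dist_nonneg (x := corner c J K) (y := x)
    linarith
  have h1 : (fun i => (K i : ℝ) * side c J + t) ∈ box c J K := fun i => ⟨by linarith, by linarith⟩
  have h2 := h h1
  have h3 := h (corner_mem_box hc J K)
  have h4 := dist_le_pi_dist (fun i => (K i : ℝ) * side c J + t) (corner c J K) ⟨0, hd⟩
  have h5 := dist_triangle_right (fun i => (K i : ℝ) * side c J + t) (corner c J K) x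
  rw [Metric.mem_closedBall] at h2 h3
  simp only [corner, Real.dist_eq, add_sub_cancel_left, abs_of_nonneg h0] at h4
  change t ≤ dist (fun i => (K i : ℝ) * side c J + t) (corner c J K) at h4
  linarith

/-- A maximal box in a small ball has side comparable to the radius. -/
lemma IsMaximalBox.le_side (hc : 2 ≤ c) {x : Fin d → ℝ} (hx : x ∈ Icc (0 : Fin d → ℝ) 1)
    {r : ℝ} (h0 : 0 < r) (h1 : r ≤ 1) {J : ℕ} {K : Fin d → ℕ}
    (h : IsMaximalBox c (Metric.closedBall x r) J K) : r ≤ c * side c J := by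
  obtain ⟨j, h2, h3⟩ := exists_side_near hc h0 h1
  obtain ⟨k, hk, hsub, -⟩ := exists_box_subset_closedBall hc hx h2.le
  have h4 := side_antitone hc (h.2.2 (j + 1) k hk hsub)
  calc r ≤ side c j := h3
    _ = c * side c (j + 1) := (side_succ hc j).symm
    _ ≤ c * side c J := mul_le_mul_of_nonneg_left h4 (Nat.cast_nonneg _)

lemma measurableSet_unitBox : MeasurableSet (unitBox d) := by
  have : unitBox d = ⋂ i, {x : Fin d → ℝ | 0 ≤ x i ∧ x i < 1} := by
    ext x; simp [unitBox]
  rw [this]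
  exact MeasurableSet.iInter fun i =>
    (measurableSet_le measurable_const (measurable_pi_apply i)).inter
      (measurableSet_lt (measurable_pi_apply i) measurable_const)

lemma measurableSet_box (j : ℕ) (k : Fin d → ℕ) : MeasurableSet (box c j k) := by
  have : box c j k = ⋂ i, {x : Fin d → ℝ | (k i : ℝ) * side c j ≤ x i ∧
      x i < ((k i : ℝ) + 1) * side c j} := by
    ext x; simp [box]
  rw [this]
  exact MeasurableSet.iInter fun i =>
    (measurableSet_le measurable_const (measurable_pi_apply i)).inter
      (measurableSet_lt (measurable_pi_apply i) measurable_const)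

/-- A measure supported by the whole closed cube charges every box. -/
lemma measure_interior_box_pos (hc : 2 ≤ c) {m : Measure (Fin d → ℝ)} (hm : m.support = Icc 0 1)
    {j : ℕ} {k : Fin d → ℕ} (hk : IsIndex c j k) : 0 < m (interior (box c j k)) := by
  have hs := side_pos hc j
  set U : Set (Fin d → ℝ) := univ.pi fun i => Ioo ((k i : ℝ) * side c j) (((k i : ℝ) + 1) * side c j)
    with hU
  have hUo : IsOpen U := isOpen_set_pi finite_univ fun i _ => isOpen_Ioo
  have hUb : U ⊆ box c j k := fun y hy i => ⟨(hy i trivial).1.le, (hy i trivial).2⟩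
  set y : Fin d → ℝ := fun i => ((k i : ℝ) + 1 / 2) * side c j
  have hy : y ∈ U := fun i _ => ⟨by simp only [y]; linarith, by simp only [y]; linarith⟩
  have hyI : y ∈ Icc (0 : Fin d → ℝ) 1 := by
    have h1 := box_subset_unitBox hc hk (hUb hy)
    exact ⟨fun i => (h1 i).1, fun i => (h1 i).2.le⟩
  rw [← hm] at hyI
  exact (Measure.mem_support_iff_forall y).1 hyI _
    (mem_of_superset (hUo.mem_nhds hy) (interior_maximal hUb hUo))

end Boxes
/-! ### Multinomial measures do not charge the upper faces of the cube -/

section Multinomial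

variable {d : ℕ} {b : ℕ}

/-- The expansion of 1 with all digits `b - 1`; it dominates every digit series. -/
lemma hasSum_last_digit (hb : 2 ≤ b) :
    HasSum (fun j : ℕ => ((b : ℝ) - 1) / (b : ℝ) ^ (j + 1)) 1 := by
  have hb' : (1 : ℝ) < b := by exact_mod_cast (by omega : 1 < b)
  have h := (hasSum_geometric_of_lt_one (r := (b : ℝ)⁻¹) (by positivity)
    (inv_lt_one_of_one_lt₀ hb')).mul_left (((b : ℝ) - 1) / b)
  have h1 : ((b : ℝ) - 1) / b * (1 - (b : ℝ)⁻¹)⁻¹ = 1 := by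
    have : (b : ℝ) - 1 ≠ 0 := by linarith
    field_simp
  rw [h1] at h
  refine h.congr_fun ?_
  intro j
  rw [pow_succ, inv_pow]; field_simp

lemma digit_le (hb : 2 ≤ b) (a : Fin b) (j : ℕ) :
    ((a : ℕ) : ℝ) / (b : ℝ) ^ (j + 1) ≤ ((b : ℝ) - 1) / (b : ℝ) ^ (j + 1) := by
  have hb' : (0 : ℝ) < b := by exact_mod_cast (by omega : 0 < b)
  refine div_le_div_of_nonneg_right ?_ (by positivity)
  have : ((a : ℕ) : ℝ) + 1 ≤ b := by exact_mod_cast a.2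
  linarith

/-- Strict termwise comparison with the expansion of 1 at position `j₀`: only the constant digit `b
- 1` reaches 1. -/
lemma digitPoint_mem_Ico (hb : 2 ≤ b) {ω : ℕ → Fin d → Fin b} {i : Fin d} {j₀ : ℕ}
    (h : ((ω j₀ i : ℕ) : ℝ) ≠ (b : ℝ) - 1) : 0 ≤ digitPoint ω i ∧ digitPoint ω i < 1 := by
  have hb' : (0 : ℝ) < b := by exact_mod_cast (by omega : 0 < b)
  refine ⟨tsum_nonneg fun j => by positivity, ?_⟩
  have h1 := hasSum_last_digit hb
  have hsum : Summable fun j : ℕ => ((ω j i : ℕ) : ℝ) / (b : ℝ) ^ (j + 1) :=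
    Summable.of_nonneg_of_le (fun j => by positivity) (fun j => digit_le hb _ j) h1.summable
  rw [← h1.tsum_eq]
  refine Summable.tsum_lt_tsum (i := j₀) (fun j => digit_le hb _ j) ?_ hsum h1.summable
  refine lt_of_le_of_ne (digit_le hb _ _) fun h2 => h ?_
  have h3 : (b : ℝ) ^ (j₀ + 1) ≠ 0 := by positivity
  exact (div_left_inj' h3).1 h2

lemma isProbabilityMeasure_digitLaw {p : (Fin d → Fin b) → ℝ} (hp : ∀ e, 0 < p e)
    (hp_sum : ∑ e, p e = 1) : IsProbabilityMeasure (digitLaw p) := by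
  refine ⟨?_⟩
  simp only [digitLaw, Measure.coe_finsetSum, Finset.sum_apply, Measure.smul_apply,
    measure_univ, smul_eq_mul, mul_one]
  rw [← ENNReal.ofReal_sum_of_nonneg fun e _ => (hp e).le, hp_sum, ENNReal.ofReal_one]

/-- The digit 0 has positive weight and differs from `b - 1` because `b ≥ 2`. -/
lemma digitLaw_last_lt_one (hb : 2 ≤ b) {p : (Fin d → Fin b) → ℝ} (hp : ∀ e, 0 < p e)
    (hp_sum : ∑ e, p e = 1) (i : Fin d) :
    digitLaw p {e | ((e i : ℕ) : ℝ) = (b : ℝ) - 1} < 1 := by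
  have := isProbabilityMeasure_digitLaw hp hp_sum
  set S : Set (Fin d → Fin b) := {e | ((e i : ℕ) : ℝ) = (b : ℝ) - 1}
  have hS : MeasurableSet S := MeasurableSet.of_discrete
  have hb' : (1 : ℝ) < b := by exact_mod_cast (by omega : 1 < b)
  set e₀ : Fin d → Fin b := fun _ => ⟨0, by omega⟩
  have he₀ : e₀ ∈ Sᶜ := by
    simp only [S, e₀, mem_compl_iff, mem_ofPred_eq, Nat.cast_zero]
    linarith
  have hpos : 0 < digitLaw p Sᶜ := by
    simp only [digitLaw, Measure.coe_finsetSum, Finset.sum_apply, Measure.smul_apply, smul_eq_mul]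
    refine lt_of_lt_of_le ?_ (Finset.single_le_sum (f := fun e => ENNReal.ofReal (p e) *
      Measure.dirac e Sᶜ) (fun _ _ => zero_le) (Finset.mem_univ e₀))
    simp only [Measure.dirac_apply' _ hS.compl, indicator_of_mem he₀, Pi.one_apply, mul_one]
    exact ENNReal.ofReal_pos.2 (hp e₀)
  have hadd := measure_add_measure_compl (μ := digitLaw p) hS
  rw [measure_univ] at hadd
  rw [← hadd]
  exact ENNReal.lt_add_right (measure_ne_top _ _) hpos.ne'

lemma isFiniteMeasure_multinomialMeasure {p : (Fin d → Fin b) → ℝ} (hp : ∀ e, 0 < p e)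
    (hp_sum : ∑ e, p e = 1) : IsFiniteMeasure (multinomialMeasure b p) := by
  have := isProbabilityMeasure_digitLaw hp hp_sum
  unfold multinomialMeasure
  infer_instance

/-- Each coordinate is a uniformly convergent series of continuous functions of the digits. -/
lemma measurable_digitPoint (hb : 2 ≤ b) :
    Measurable (digitPoint : (ℕ → Fin d → Fin b) → Fin d → ℝ) := by
  refine measurable_pi_lambda _ fun i => ?_
  have hb' : (0 : ℝ) < b := by exact_mod_cast (by omega : 0 < b)
  refine Continuous.measurable (continuous_tsum (u := fun j : ℕ => ((b : ℝ) - 1) / (b : ℝ) ^ (j + 1))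
    (fun j => ?_) (hasSum_last_digit hb).summable fun j ω => ?_)
  · exact (continuous_of_discreteTopology (f := fun a : Fin b => ((a : ℕ) : ℝ))).comp
      ((continuous_apply i).comp (continuous_apply j)) |>.div_const _
  · rw [Real.norm_of_nonneg (by positivity)]
    exact digit_le hb _ j

/-- A multinomial measure is carried by the half-open unit cube. -/
lemma multinomialMeasure_compl_unitBox (hb : 2 ≤ b) {p : (Fin d → Fin b) → ℝ} (hp : ∀ e, 0 < p e)
    (hp_sum : ∑ e, p e = 1) : multinomialMeasure b p (unitBox d)ᶜ = 0 := by
  have := isProbabilityMeasure_digitLaw hp hp_sum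
  rw [multinomialMeasure, Measure.map_apply (measurable_digitPoint hb) measurableSet_unitBox.compl]
  have hsub : digitPoint ⁻¹' (unitBox d)ᶜ ⊆
      ⋃ i : Fin d, {ω : ℕ → Fin d → Fin b | ∀ j, ((ω j i : ℕ) : ℝ) = (b : ℝ) - 1} := by
    intro ω hω
    by_contra hcon
    simp only [mem_iUnion, mem_ofPred_eq, not_exists, not_forall] at hcon
    exact hω fun i => (hcon i).elim fun j hj => digitPoint_mem_Ico hb hj
  refine measure_mono_null hsub (measure_iUnion_null fun i => ?_)
  -- By independence, prescribing the first `n` digits costs the `n`-th power of a number less than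
  -- one.
  have hle : ∀ n : ℕ, (Measure.infinitePi fun _ : ℕ => digitLaw p)
      {ω : ℕ → Fin d → Fin b | ∀ j, ((ω j i : ℕ) : ℝ) = (b : ℝ) - 1} ≤
      digitLaw p {e | ((e i : ℕ) : ℝ) = (b : ℝ) - 1} ^ n := by
    intro n
    refine (measure_mono (t := Set.pi (Finset.range n : Set ℕ)
      fun _ => {e : Fin d → Fin b | ((e i : ℕ) : ℝ) = (b : ℝ) - 1}) ?_).trans ?_
    · exact fun ω hω j _ => hω j
    · rw [Measure.infinitePi_pi _ fun _ _ => MeasurableSet.of_discrete]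
      simp
  exact le_antisymm (ge_of_tendsto' (ENNReal.tendsto_pow_atTop_nhds_zero_of_lt_one
    (digitLaw_last_lt_one hb hp hp_sum i)) hle) (zero_le)

end Multinomial
/-! ### Balls centred near points with good local scaling -/

section Scaling

variable {d c : ℕ} {φ ψ : ℝ → ℝ}

lemma IsGaugePair.phi_nonneg (h : IsGaugePair φ ψ) {t : ℝ} (ht : 0 ≤ t) : 0 ≤ φ t := by
  rw [← h.phi_zero]; exact h.monotone_phi self_mem_Ici ht ht

lemma IsGaugePair.psi_nonneg (h : IsGaugePair φ ψ) {t : ℝ} (ht : 0 ≤ t) : 0 ≤ ψ t := by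
  rw [← h.psi_zero]; exact h.monotone_psi self_mem_Ici ht ht

lemma IsGaugePair.tendsto_phi_zero (h : IsGaugePair φ ψ) : Tendsto φ (𝓝[>] 0) (𝓝 0) := by
  have := (h.continuous_phi 0 self_mem_Ici).mono Ioi_subset_Ici_self
  rwa [ContinuousWithinAt, h.phi_zero] at this

lemma IsGaugePair.tendsto_psi_zero (h : IsGaugePair φ ψ) : Tendsto ψ (𝓝[>] 0) (𝓝 0) := by
  have := (h.continuous_psi 0 self_mem_Ici).mono Ioi_subset_Ici_self
  rwa [ContinuousWithinAt, h.psi_zero] at this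

/-- The constant in the error exponent of the scaling of balls. -/
noncomputable def errorConst (d c : ℕ) (α : ℝ) (ψ : ℝ → ℝ) : ℝ :=
  (α + ψ 1) * Real.log (2 * c) + d * Real.log 3

/-- If the boxes near `y` scale well, then so do the balls whose middle half contains `y`. -/
lemma measure_closedBall_scaling (hc : 2 ≤ c) (hg : IsGaugePair φ ψ) {μ : Measure (Fin d → ℝ)}
    [IsFiniteMeasure μ] (hμ : μ (unitBox d)ᶜ = 0) {α : ℝ} (hα : 0 < α) {y x : Fin d → ℝ}
    (hy : y ∈ unitBox d) {j₀ : ℕ}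
    (hj₀ : ∀ j, j₀ ≤ j → ∀ k : Fin d → ℕ, IsIndex c j k → Near k (boxIndex c j y) →
      side c j ^ (α + ψ (side c j)) ≤ μ.real (box c j k) ∧
      μ.real (box c j k) ≤ side c j ^ (α - ψ (side c j)))
    {l e : ℝ} (hl : 0 < l) (hl' : 2 * c * l ≤ side c j₀)
    (he : ψ (2 * c * l) + errorConst d c α ψ / (-Real.log l) ≤ e)
    (hyx : y ∈ Metric.closedBall x (l / 2)) :
    l ^ (α + e) ≤ μ.real (Metric.closedBall x l) ∧
      μ.real (Metric.closedBall x l) ≤ l ^ (α - e) := by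
  have hc2 : (2 : ℝ) ≤ c := by exact_mod_cast hc
  have hl1 : 2 * c * l ≤ 1 := hl'.trans (side_le_one hc j₀)
  have hlc : 4 * l ≤ 2 * c * l := by nlinarith
  have hlog : Real.log l < 0 := Real.log_neg hl (by linarith)
  have hlogc : 0 < Real.log (2 * c) := Real.log_pos (by linarith)
  set P := ψ (2 * c * l) with hP
  have hP0 : 0 ≤ P := hg.psi_nonneg (by positivity)
  have hP1 : P ≤ ψ 1 := hg.monotone_psi (mem_Ici.2 (by positivity)) (mem_Ici.2 zero_le_one) hl1
  have hlog3 : 0 ≤ d * Real.log 3 := mul_nonneg (Nat.cast_nonneg _) (Real.log_nonneg (by norm_num))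
  have hA : (α + P) * Real.log (2 * c) + d * Real.log 3 ≤ errorConst d c α ψ := by
    unfold errorConst
    have := mul_le_mul_of_nonneg_right hP1 hlogc.le
    linarith
  set A := errorConst d c α ψ with hAdef
  -- Equivalently `l ^ e ≤ l ^ P * exp (-A)`: the error exponent absorbs both the gauge and all
  -- multiplicative constants.
  have hE : e * Real.log l ≤ P * Real.log l - A := by
    have h1 := mul_le_mul_of_nonneg_right he (neg_pos.2 hlog).le
    rw [add_mul, div_mul_cancel₀ _ (neg_pos.2 hlog).ne'] at h1
    linarith
  have hmono : ∀ {t : ℝ}, 0 ≤ t → t ≤ 2 * c * l → ψ t ≤ P := fun ht ht' =>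
    hg.monotone_psi (mem_Ici.2 ht) (mem_Ici.2 (ht.trans ht')) ht'
  constructor
  -- Lower bound: the box around `y` with side `a` in `[l / (2c), l / 2)` lies inside `B(x, l)`.
  · obtain ⟨j, h1, h2⟩ := exists_side_near hc (half_pos hl) (by linarith)
    have h3 : j₀ ≤ j + 1 := by
      by_contra hcon
      have := side_antitone hc (by omega : j + 1 ≤ j₀)
      linarith
    set a := side c (j + 1) with ha
    have ha0 : 0 < a := side_pos hc _
    have hsub : box c (j + 1) (boxIndex c (j + 1) y) ⊆ Metric.closedBall x l := by
      refine (box_subset_closedBall_of_mem hc (mem_box_boxIndex hc _ hy)).trans ?_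
      refine Metric.closedBall_subset_closedBall' ?_
      have := Metric.mem_closedBall.1 hyx
      linarith
    refine le_trans ?_ ((hj₀ (j + 1) h3 _ (isIndex_boxIndex hc _ hy) (near_refl _)).1.trans
      (measureReal_mono hsub))
    rw [← ha, Real.rpow_def_of_pos hl, Real.rpow_def_of_pos ha0, Real.exp_le_exp]
    have h4 : Real.log l - Real.log (2 * c) ≤ Real.log a := by
      rw [← Real.log_div hl.ne' (by positivity)]
      refine Real.log_le_log (by positivity) ?_
      rw [div_le_iff₀ (by positivity)]
      have := side_succ hc j
      rw [← ha] at this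
      linarith
    have h5 : Real.log a ≤ 0 := Real.log_nonpos ha0.le (by linarith)
    have h6 : ψ a ≤ P := hmono ha0.le (by linarith)
    have h7 : 0 ≤ (P - ψ a) * (-Real.log a) := mul_nonneg (by linarith) (by linarith)
    have h8 := mul_le_mul_of_nonneg_left h4 (by linarith : 0 ≤ α + P)
    linarith
  -- Upper bound: `B(x, l)` lies in `B(y, 2l)`, which is covered up to a null set by at most `3 ^ d`
  -- boxes of side in `[2l, 2cl)`.
  · obtain ⟨j, h1, h2⟩ := exists_side_near hc (by linarith : 0 < 2 * l) (by linarith)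
    set a := side c j with ha
    have ha0 : 0 < a := side_pos hc _
    have hal : a ≤ 2 * c * l := by
      rw [ha, ← side_succ hc j]
      nlinarith
    have hal' : a < 2 * c * l := by
      rw [ha, ← side_succ hc j]
      nlinarith
    have h3 : j₀ ≤ j := by
      by_contra hcon
      have := side_antitone hc (by omega : j ≤ j₀)
      linarith
    have hsub : Metric.closedBall x l ⊆ Metric.closedBall y (2 * l) := by
      refine Metric.closedBall_subset_closedBall' ?_
      have := Metric.mem_closedBall'.1 hyx
      linarith
    refine (measureReal_mono hsub).trans ((measureReal_closedBall_le_of_near hc hμ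
      (fun i => (hy i).1) h2 (by positivity) fun k hk hn => (hj₀ j h3 k hk hn).2).trans ?_)
    rw [← ha, Real.rpow_def_of_pos hl, Real.rpow_def_of_pos ha0,
      ← Real.exp_log (by norm_num : (0 : ℝ) < 3), ← Real.exp_nat_mul, ← Real.exp_add,
      Real.exp_le_exp]
    have h4 : Real.log a ≤ Real.log l + Real.log (2 * c) := by
      rw [← Real.log_mul hl.ne' (by positivity)]
      exact Real.log_le_log ha0 (by linarith)
    have h5 : Real.log l ≤ Real.log a := Real.log_le_log hl (by linarith)
    have h6 : ψ a ≤ P := hmono ha0.le hal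
    have h9 : Real.log a ≤ 0 := Real.log_nonpos ha0.le (by linarith)
    have h7 : 0 ≤ (P - ψ a) * (-Real.log a) := mul_nonneg (by linarith) (by linarith)
    have h8 := mul_le_mul_of_nonneg_left h4 hα.le
    have h10 := mul_le_mul_of_nonneg_left h5 hP0
    have h11 := mul_nonneg hP0 hlogc.le
    linarith

/-- A sequence of errors, converging to zero, with which almost every point scales well. -/
lemma exists_scaling_errors (hc : 2 ≤ c) (hg : IsGaugePair φ ψ) {μ m : Measure (Fin d → ℝ)}
    [IsFiniteMeasure μ] (hμ : μ (unitBox d)ᶜ = 0) {α : ℝ} (hα : 0 < α)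
    (hscal : LocalScaling c m μ α ψ) (x : ℕ → Fin d → ℝ) {lam : ℕ → ℝ} (hpos : ∀ n, 0 < lam n)
    (hlim : Tendsto lam atTop (𝓝 0)) :
    ∃ ε : ℕ → ℝ, (∀ n, 0 < ε n) ∧ Tendsto ε atTop (𝓝 0) ∧
      ∀ᵐ y ∂m, y ∈ unitBox d → ∃ η > 0, ∀ n, lam n ≤ η →
        y ∈ Metric.closedBall (x n) (lam n / 2) →
        lam n ^ (α + ε n) ≤ μ.real (Metric.closedBall (x n) (lam n)) ∧
          μ.real (Metric.closedBall (x n) (lam n)) ≤ lam n ^ (α - ε n) := by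
  have hc2 : (2 : ℝ) ≤ c := by exact_mod_cast hc
  have hA : 0 < errorConst d c α ψ := by
    have h1 : 0 < Real.log (2 * c) := Real.log_pos (by linarith)
    have h2 := hg.psi_nonneg zero_le_one
    have h3 : 0 ≤ d * Real.log 3 :=
      mul_nonneg (Nat.cast_nonneg _) (Real.log_nonneg (by norm_num))
    unfold errorConst
    positivity
  set e : ℕ → ℝ := fun n => ψ (2 * c * lam n) + errorConst d c α ψ / (-Real.log (lam n)) with he
  have hlim' : Tendsto lam atTop (𝓝[>] 0) :=
    tendsto_nhdsWithin_iff.2 ⟨hlim, Eventually.of_forall hpos⟩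
  have hlim2 : Tendsto (fun n => 2 * c * lam n) atTop (𝓝[>] 0) := by
    refine tendsto_nhdsWithin_iff.2 ⟨by simpa using hlim.const_mul (2 * (c : ℝ)), ?_⟩
    exact Eventually.of_forall fun n => mem_Ioi.2 (by have := hpos n; positivity)
  have hte : Tendsto e atTop (𝓝 0) := by
    rw [← add_zero (0 : ℝ)]
    refine (hg.tendsto_psi_zero.comp hlim2).add (Tendsto.div_atTop tendsto_const_nhds ?_)
    exact tendsto_neg_atBot_atTop.comp (Real.tendsto_log_nhdsGT_zero.comp hlim')
  -- For `lam n ≥ 1` the logarithm has the wrong sign; the value 1 only keeps the sequence positive.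
  refine ⟨fun n => if lam n < 1 then e n else 1, fun n => ?_, ?_, ?_⟩
  · beta_reduce
    split_ifs with h
    · have h1 := hpos n
      have h2 := Real.log_neg h1 h
      have h3 : 0 ≤ ψ (2 * c * lam n) := hg.psi_nonneg (by positivity)
      have h4 := div_pos hA (neg_pos.2 h2)
      simp only [he]
      linarith
    · exact one_pos
  · refine hte.congr' ?_
    filter_upwards [hlim.eventually_lt_const one_pos] with n hn
    rw [if_pos hn]
  · filter_upwards [hscal] with y hy hyu
    obtain ⟨j₀, hj₀⟩ := hy hyu
    have hs := side_pos hc j₀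
    refine ⟨side c j₀ / (2 * c), by positivity, fun n hn hyn => ?_⟩
    rw [le_div_iff₀ (by positivity)] at hn
    have h1 := hpos n
    have hlt : lam n < 1 := by
      have := side_le_one hc j₀
      nlinarith
    rw [if_pos hlt]
    exact measure_closedBall_scaling hc hg hμ hα hyu hj₀ h1 (by linarith) le_rfl hyn

end Scaling
/-! ### Growth of the measures carried by the boxes -/

section Growth

variable {d c : ℕ} {φ ψ : ℝ → ℝ}

/-- Powers with the gauge `φ` in the exponent are dominated by any smaller power. -/
lemma IsGaugePair.exists_rpow_sub_phi_le (h : IsGaugePair φ ψ) {β β₁ : ℝ} (hβ₁ : 0 < β₁)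
    (hβ : β₁ < β) : ∃ C : ℝ, 1 ≤ C ∧ ∀ t, 0 < t → t ≤ 1 → t ^ (β - φ t) ≤ C * t ^ β₁ := by
  have h1 : ∀ᶠ t in 𝓝[>] (0 : ℝ), φ t < β - β₁ :=
    h.tendsto_phi_zero.eventually_lt_const (sub_pos.2 hβ)
  obtain ⟨t₀, ht₀, hsub⟩ := mem_nhdsGT_iff_exists_Ioo_subset.1 h1
  have ht₀' : (0 : ℝ) < t₀ := ht₀
  -- Below `t₀` the gauge is smaller than `β - β₁`; on `[t₀, 1]` both sides are compared with their
  -- crude bounds at `t₀`.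
  refine ⟨max 1 (t₀ ^ (-φ 1) / t₀ ^ β₁), le_max_left _ _, fun t ht ht1 => ?_⟩
  have hp : 0 < t ^ β₁ := Real.rpow_pos_of_pos ht _
  rcases lt_or_ge t t₀ with hlt | hge
  · have h2 : φ t < β - β₁ := hsub ⟨ht, hlt⟩
    calc t ^ (β - φ t) ≤ t ^ β₁ := Real.rpow_le_rpow_of_exponent_ge ht ht1 (by linarith)
      _ ≤ _ := le_mul_of_one_le_left hp.le (le_max_left _ _)
  · have h3 : φ t ≤ φ 1 := h.monotone_phi (mem_Ici.2 ht.le) (mem_Ici.2 zero_le_one) ht1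
    have h4 := h.phi_nonneg zero_le_one
    have hq : 0 < t₀ ^ β₁ := Real.rpow_pos_of_pos ht₀' _
    calc t ^ (β - φ t) ≤ t ^ (-φ 1) :=
          Real.rpow_le_rpow_of_exponent_ge ht ht1 (by linarith)
      _ ≤ t₀ ^ (-φ 1) := Real.rpow_le_rpow_of_nonpos ht₀' hge (by linarith)
      _ = t₀ ^ (-φ 1) / t₀ ^ β₁ * t₀ ^ β₁ := by field_simp
      _ ≤ max 1 (t₀ ^ (-φ 1) / t₀ ^ β₁) * t ^ β₁ := by
          refine mul_le_mul (le_max_right _ _) (Real.rpow_le_rpow ht₀'.le hge hβ₁.le) hq.le ?_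
          exact zero_le_one.trans (le_max_left _ _)

/-- A lower power dominates any multiple of a higher power near zero. -/
lemma eventually_mul_rpow_le (A : ℝ) {p q : ℝ} (hpq : p < q) :
    ∀ᶠ l in 𝓝[>] (0 : ℝ), A * l ^ q ≤ l ^ p := by
  have h1 : Tendsto (fun l : ℝ => A * l ^ (q - p)) (𝓝[>] 0) (𝓝 0) := by
    have h2 : Tendsto (fun l : ℝ => l ^ (q - p)) (𝓝[>] 0) (𝓝 ((0 : ℝ) ^ (q - p))) :=
      ((Real.continuousAt_rpow_const 0 (q - p) (Or.inr (sub_pos.2 hpq).le)).tendsto).mono_left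
        nhdsWithin_le_nhds
    rw [Real.zero_rpow (sub_pos.2 hpq).ne'] at h2
    simpa using h2.const_mul A
  filter_upwards [h1.eventually_lt_const one_pos, self_mem_nhdsWithin] with l hl hl0
  have hl0' : 0 < l := hl0
  have h3 : 0 < l ^ p := Real.rpow_pos_of_pos hl0' _
  calc A * l ^ q = A * l ^ (q - p) * l ^ p := by
        rw [mul_assoc, ← Real.rpow_add hl0', sub_add_cancel]
    _ ≤ 1 * l ^ p := mul_le_mul_of_nonneg_right hl.le h3.le
    _ = l ^ p := one_mul _

lemma measurable_boxMap (j : ℕ) (k : Fin d → ℕ) : Measurable (boxMap c j k) :=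
  measurable_pi_lambda _ fun i => ((measurable_pi_apply i).const_mul _).sub_const _

/-- The map onto the unit cube shifts the generation by `J` and the index by the integer `c ^ j *
K`, so it carries subboxes and floors to subboxes and floors. -/
lemma mul_boxMap_sub (J j : ℕ) (K : Fin d → ℕ) (y : Fin d → ℝ) (i : Fin d) :
    (c : ℝ) ^ j * boxMap c J K y i = (c : ℝ) ^ (J + j) * y i - (c ^ j * K i : ℕ) := by
  simp only [boxMap, pow_add]
  push_cast
  ring

variable {μ m : Measure (Fin d → ℝ)} {α β : ℝ} {x : ℕ → Fin d → ℝ} {lam : ℕ → ℝ} {D : Set ℝ}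
  {mL : ℕ → (Fin d → ℕ) → Measure (Fin d → ℝ)}

lemma IsHeterogeneousUbiquitousWith.mL_compl_box
    (H : IsHeterogeneousUbiquitousWith c μ α β x lam D φ ψ m mL) {J : ℕ} {K : Fin d → ℕ}
    (hK : IsIndex c J K) : mL J K (box c J K)ᶜ = 0 := by
  refine H.mL_abs J K hK ?_
  rw [Measure.restrict_apply (measurableSet_box J K).compl, compl_inter_self, measure_empty]

lemma IsHeterogeneousUbiquitousWith.mL_compl_unitBox (hc : 2 ≤ c)
    (H : IsHeterogeneousUbiquitousWith c μ α β x lam D φ ψ m mL) {J : ℕ} {K : Fin d → ℕ}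
    (hK : IsIndex c J K) : mL J K (unitBox d)ᶜ = 0 :=
  measure_mono_null (compl_subset_compl.2 (box_subset_unitBox hc hK)) (H.mL_compl_box hK)

/-- Almost every point of the box `L` belongs to some growth set. -/
lemma IsHeterogeneousUbiquitousWith.ae_mem_growthSet (hc : 2 ≤ c)
    (H : IsHeterogeneousUbiquitousWith c μ α β x lam D φ ψ m mL) {J : ℕ} {K : Fin d → ℕ}
    (hK : IsIndex c J K) :
    ∀ᵐ y ∂(mL J K), ∃ n : ℕ, y ∈ growthSet c β φ (mL J K) J K n := by
  have hc0 : 0 < c := by omega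
  have := H.finite_mL J K hK
  have h1 := ae_of_ae_map (measurable_boxMap (c := c) J K).aemeasurable (H.upper_mL J K hK)
  have h2 : ∀ᵐ y ∂(mL J K), y ∈ box c J K := by
    rw [ae_iff]; exact H.mL_compl_box hK
  filter_upwards [h1, h2] with y hy hyL
  have hyu : boxMap c J K y ∈ unitBox d := by
    intro i
    obtain ⟨h3, h4⟩ := hyL i
    have h5 : (0 : ℝ) < (c : ℝ) ^ J := by positivity
    have h6 := pow_mul_side hc J
    have h7 := mul_le_mul_of_nonneg_left h3 h5.le
    have h8 := mul_lt_mul_of_pos_left h4 h5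
    rw [mul_left_comm, h6, mul_one] at h7 h8
    simp only [boxMap]
    constructor <;> linarith
  obtain ⟨n, hn⟩ := hy hyu
  refine ⟨n, hyL, fun j hj k hk hnear => ?_⟩
  obtain ⟨j', rfl⟩ : ∃ j', j = J + j' := ⟨j - J, by omega⟩
  have hside : side c (J + j') / side c J = side c j' := by
    rw [side_add]; exact mul_div_cancel_left₀ _ (side_pos hc J).ne'
  rw [hside]
  have hnn : (0 : ℝ) ≤ side c j' ^ (β - φ (side c j')) :=
    Real.rpow_nonneg (side_pos hc _).le _
  -- A neighbouring box is either contained in `L`, where the bound on the image measure transfers,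
  -- or disjoint from `L`, where `m^L` vanishes.
  by_cases hin : ∀ i, c ^ j' * K i ≤ k i ∧ k i < c ^ j' * (K i + 1)
  · set k' : Fin d → ℕ := fun i => k i - c ^ j' * K i with hk'
    have hkk : ∀ i, k i = k' i + c ^ j' * K i := fun i => by
      have := (hin i).1; simp only [hk']; omega
    have hpre : (boxMap c J K) ⁻¹' (box c j' k') = box c (J + j') k := by
      ext w
      simp only [mem_preimage, box, mem_ofPred_eq]
      refine forall_congr' fun i => ?_
      have hs := side_pos hc j'
      have hcj : (0 : ℝ) < (c : ℝ) ^ j' := by positivity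
      have hcJ : (0 : ℝ) < (c : ℝ) ^ (J + j') := by positivity
      have e1 : ∀ a b : ℝ, (a * side c j' ≤ b ↔ a ≤ (c : ℝ) ^ j' * b) := by
        intro a b
        rw [side, ← div_eq_mul_inv, div_le_iff₀ hcj, mul_comm b]
      have e2 : ∀ a b : ℝ, (b < a * side c j' ↔ (c : ℝ) ^ j' * b < a) := by
        intro a b
        rw [side, ← div_eq_mul_inv, lt_div_iff₀ hcj, mul_comm b]
      have e3 : ∀ a b : ℝ, (a * side c (J + j') ≤ b ↔ a ≤ (c : ℝ) ^ (J + j') * b) := by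
        intro a b
        rw [side, ← div_eq_mul_inv, div_le_iff₀ hcJ, mul_comm b]
      have e4 : ∀ a b : ℝ, (b < a * side c (J + j') ↔ (c : ℝ) ^ (J + j') * b < a) := by
        intro a b
        rw [side, ← div_eq_mul_inv, lt_div_iff₀ hcJ, mul_comm b]
      rw [e1, e2, e3, e4, mul_boxMap_sub, hkk i]
      push_cast
      constructor <;> rintro ⟨h3, h4⟩ <;> constructor <;> linarith
    have hidx : IsIndex c j' k' := fun i => by
      obtain ⟨h4, h3⟩ := hin i
      simp only [hk']
      rw [mul_add, mul_one] at h3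
      omega
    have hfl : ∀ i, boxIndex c j' (boxMap c J K y) i =
        boxIndex c (J + j') y i - c ^ j' * K i := by
      intro i
      simp only [boxIndex]
      rw [mul_boxMap_sub, Nat.floor_sub_natCast]
    have hge : ∀ i, c ^ j' * K i ≤ boxIndex c (J + j') y i := by
      intro i
      refine Nat.le_floor ?_
      have h5 : (0 : ℝ) ≤ (c : ℝ) ^ j' * boxMap c J K y i :=
        mul_nonneg (by positivity) (hyu i).1
      rw [mul_boxMap_sub] at h5
      linarith
    have hnear' : Near k' (boxIndex c j' (boxMap c J K y)) := by
      intro i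
      have h3 := hnear i
      have h4 := hge i
      have h5 := hkk i
      rw [hfl]
      omega
    have h9 := hn j' (by omega) k' hidx hnear'
    rwa [measureReal_def, Measure.map_apply (measurable_boxMap J K) (measurableSet_box j' k'), hpre,
      ← measureReal_def] at h9
  · refine le_trans (le_of_eq ?_) hnn
    have hdis : box c (J + j') k ⊆ (box c J K)ᶜ := by
      intro w hw hwL
      refine hin fun i => ?_
      have hs' : side c J = (c : ℝ) ^ j' * side c (J + j') := by
        rw [side_add, mul_left_comm, pow_mul_side hc, mul_one]
      obtain ⟨h3, h4⟩ := hw i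
      obtain ⟨h5, h6⟩ := hwL i
      rw [hs'] at h5 h6
      have hs := side_pos hc (J + j')
      have h7 : (K i : ℝ) * (c : ℝ) ^ j' < k i + 1 := by
        refine lt_of_mul_lt_mul_right ?_ hs.le
        linarith
      have h8 : (k i : ℝ) < ((K i : ℝ) + 1) * (c : ℝ) ^ j' := by
        refine lt_of_mul_lt_mul_right ?_ hs.le
        linarith
      constructor
      · have : K i * c ^ j' < k i + 1 := by exact_mod_cast h7
        rw [mul_comm]; omega
      · have : k i < (K i + 1) * c ^ j' := by exact_mod_cast h8
        rwa [mul_comm]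
    rw [measureReal_def, measure_mono_null hdis (H.mL_compl_box hK), ENNReal.toReal_zero]

/-- The growth set of index `n_L` carries at least half of the mass of `m^L`. -/
lemma IsHeterogeneousUbiquitousWith.half_le_growthSet (hc : 2 ≤ c)
    (H : IsHeterogeneousUbiquitousWith c μ α β x lam D φ ψ m mL) {J : ℕ} {K : Fin d → ℕ}
    (hK : IsIndex c J K) :
    1 ≤ growthIndex c β φ (mL J K) J K ∧ (mL J K).real univ / 2 ≤
      (mL J K).real (growthSet c β φ (mL J K) J K (growthIndex c β φ (mL J K) J K)) := by
  have := H.finite_mL J K hK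
  -- The infimum is attained only if the set is nonempty. The growth sets increase to a set of full
  -- measure, so some index carries half of the mass.
  refine Nat.sInf_mem (s := {n : ℕ | 1 ≤ n ∧ (mL J K).real univ / 2 ≤
    (mL J K).real (growthSet c β φ (mL J K) J K n)}) ?_
  rcases (measureReal_nonneg (μ := mL J K) (s := univ)).eq_or_lt with h0 | h0
  · exact ⟨1, le_rfl, by rw [← h0, zero_div]; exact measureReal_nonneg⟩
  have hmono : Monotone fun n => growthSet c β φ (mL J K) J K n := fun n n' hnn y hy =>
    ⟨hy.1, fun j hj => hy.2 j (by omega)⟩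
  have h1 : mL J K univ = mL J K (⋃ n, growthSet c β φ (mL J K) J K n) := by
    refine (measure_congr ?_).symm
    refine eventuallyEq_univ.2 ?_
    filter_upwards [H.ae_mem_growthSet hc hK] with y hy
    exact mem_iUnion.2 hy
  have h2 := tendsto_measure_iUnion_atTop (μ := mL J K) hmono
  rw [← h1] at h2
  have h3 : Tendsto (fun n => (mL J K).real (growthSet c β φ (mL J K) J K n)) atTop
      (𝓝 ((mL J K).real univ)) := (ENNReal.tendsto_toReal (measure_ne_top _ _)).comp h2
  obtain ⟨n, hn, hn1⟩ := ((h3.eventually_const_lt (half_lt_self h0)).and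
    (eventually_ge_atTop 1)).exists
  exact ⟨n, hn1, hn.le⟩

/-- The mass of a small ball centred in a growth set. -/
lemma IsHeterogeneousUbiquitousWith.mL_closedBall_le (hc : 2 ≤ c)
    (H : IsHeterogeneousUbiquitousWith c μ α β x lam D φ ψ m mL) {J : ℕ} {K : Fin d → ℕ}
    (hK : IsIndex c J K) {C β₁ : ℝ} (hC : 1 ≤ C) (hβ₁ : 0 < β₁)
    (hCφ : ∀ t, 0 < t → t ≤ 1 → t ^ (β - φ t) ≤ C * t ^ β₁) {n : ℕ} {y : Fin d → ℝ}
    (hy : y ∈ growthSet c β φ (mL J K) J K n) {R : ℝ} (hR : 0 < R) (hR' : R ≤ side c (n + J)) :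
    (mL J K).real (Metric.closedBall y R) ≤ 3 ^ d * (C * (c * R / side c J) ^ β₁) := by
  have := H.finite_mL J K hK
  have hsJ := side_pos hc J
  -- Boxes of side in `[R, cR)`: their generation is at least `n + J`, so the growth set controls
  -- them.
  obtain ⟨j, h1, h2⟩ := exists_side_near hc hR (hR'.trans (side_le_one hc _))
  have hj : n + J ≤ j := by
    by_contra hcon
    have := side_antitone hc (by omega : j + 1 ≤ n + J)
    linarith
  have hyu := box_subset_unitBox hc hK hy.1
  have hsj := side_pos hc j
  have ht0 : 0 < side c j / side c J := div_pos hsj hsJ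
  have ht1 : side c j / side c J ≤ 1 := (div_le_one hsJ).2 (side_antitone hc (by omega))
  refine (measureReal_closedBall_le_of_near hc (H.mL_compl_unitBox hc hK) (fun i => (hyu i).1) h2
    (Real.rpow_nonneg ht0.le _) fun k hk hn => hy.2 j hj k hk hn).trans ?_
  refine mul_le_mul_of_nonneg_left ((hCφ _ ht0 ht1).trans ?_) (by positivity)
  refine mul_le_mul_of_nonneg_left (Real.rpow_le_rpow ht0.le ?_ hβ₁.le) (by linarith)
  refine div_le_div_of_nonneg_right ?_ hsJ.le
  rw [← side_succ hc j]
  exact mul_le_mul_of_nonneg_left h1.le (Nat.cast_nonneg _)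

end Growth
/-! ### Subdivision of the good boxes and the lower bound -/

/-- A countable family of sets contains a finite subfamily which carries weights, dominated on
each subfamily by the measure of the union and exhausting almost all of the total mass. -/
lemma exists_finset_weights {X ι : Type*} [MeasurableSpace X] (m : Measure X) [IsFiniteMeasure m]
    {u : Set ι} (hu : u.Countable) {U : ι → Set X} (hU : ∀ i, MeasurableSet (U i)) {M : ℝ}
    (hM : M < m.real (⋃ i ∈ u, U i)) :
    ∃ (T : Finset ι) (a : ι → ℝ), (↑T ⊆ u) ∧ (∀ i, 0 ≤ a i) ∧ M < ∑ i ∈ T, a i ∧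
      ∀ T' ⊆ T, ∑ i ∈ T', a i ≤ m.real (⋃ i ∈ T', U i) := by
  classical
  -- Each set receives the mass it adds to the union of those inserted before it; overlaps are thus
  -- counted once.
  have weights : ∀ T : Finset ι, ∃ a : ι → ℝ, (∀ i, 0 ≤ a i) ∧
      ∑ i ∈ T, a i = m.real (⋃ i ∈ T, U i) ∧
      ∀ T' ⊆ T, ∑ i ∈ T', a i ≤ m.real (⋃ i ∈ T', U i) := by
    intro T
    induction T using Finset.induction_on with
    | empty => exact ⟨0, fun _ => le_rfl, by simp, fun T' hT' => by
        rw [Finset.subset_empty.1 hT']; simp⟩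
    | insert i T hi ih =>
      obtain ⟨a, h1, h2, h3⟩ := ih
      have hUT : MeasurableSet (⋃ j ∈ T, U j) := T.measurableSet_biUnion fun j _ => hU j
      have hsame : ∀ T' ⊆ T, ∑ j ∈ T', Function.update a i (m.real (U i \ ⋃ j ∈ T, U j)) j =
          ∑ j ∈ T', a j := fun T' hT' => Finset.sum_congr rfl fun j hj => by
        rw [Function.update_of_ne]; rintro rfl; exact hi (hT' hj)
      refine ⟨Function.update a i (m.real (U i \ ⋃ j ∈ T, U j)), fun j => ?_, ?_, fun T' hT' => ?_⟩
      · by_cases hj : j = i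
        · subst hj; rw [Function.update_self]; exact measureReal_nonneg
        · rw [Function.update_of_ne hj]; exact h1 j
      · rw [Finset.sum_insert hi, Function.update_self, hsame T Subset.rfl, h2,
          Finset.set_biUnion_insert, ← measureReal_union disjoint_sdiff_left hUT (measure_ne_top _ _)
            (measure_ne_top _ _), sdiff_union_self]
      · by_cases hiT : i ∈ T'
        · have hsub : T'.erase i ⊆ T := by
            rw [← Finset.erase_insert hi]; exact Finset.erase_subset_erase i hT'
          rw [← Finset.insert_erase hiT, Finset.sum_insert (Finset.notMem_erase _ _),
            Function.update_self, hsame _ hsub, Finset.set_biUnion_insert]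
          have hdisj : Disjoint (U i \ ⋃ j ∈ T, U j) (⋃ j ∈ T'.erase i, U j) :=
            disjoint_sdiff_left.mono_right (biUnion_subset_biUnion_left hsub)
          calc _ ≤ m.real (U i \ ⋃ j ∈ T, U j) + m.real (⋃ j ∈ T'.erase i, U j) :=
                add_le_add le_rfl (h3 _ hsub)
            _ = m.real ((U i \ ⋃ j ∈ T, U j) ∪ ⋃ j ∈ T'.erase i, U j) :=
                (measureReal_union hdisj (Finset.measurableSet_biUnion _ fun j _ => hU j)
                  (measure_ne_top _ _) (measure_ne_top _ _)).symm
            _ ≤ _ := measureReal_mono (union_subset_union_left _ sdiff_subset)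
        · have hsub : T' ⊆ T := (Finset.subset_insert_iff_of_notMem hiT).1 hT'
          rw [hsame T' hsub]
          exact h3 T' hsub
  have := hu.to_subtype
  have hun : (⋃ i ∈ u, U i) = ⋃ T : Finset u, ⋃ i ∈ T, U i := by
    ext y
    simp only [mem_iUnion]
    constructor
    · rintro ⟨i, hi, hy⟩
      exact ⟨{⟨i, hi⟩}, ⟨i, hi⟩, by simp, hy⟩
    · rintro ⟨T, i, -, hy⟩
      exact ⟨i, i.2, hy⟩
  have hdir : Directed (· ⊆ ·) fun T : Finset u => ⋃ i ∈ T, U i :=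
    directed_of_isDirected_le fun T T' h => biUnion_subset_biUnion_left h
  obtain ⟨T, hT⟩ : ∃ T : Finset u, M < m.real (⋃ i ∈ T, U i) := by
    by_contra! hcon
    have h0 : 0 ≤ M := measureReal_nonneg.trans (hcon ∅)
    refine absurd hM (not_lt.2 ?_)
    rw [hun, measureReal_def, hdir.measure_iUnion]
    refine ENNReal.toReal_le_of_le_ofReal h0 (iSup_le fun T => ?_)
    rw [ENNReal.le_ofReal_iff_toReal_le (measure_ne_top _ _) h0]
    exact hcon T
  have hTun : (⋃ i ∈ T, U (i : ι)) = ⋃ i ∈ T.map (Function.Embedding.subtype _), U i := by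
    ext y; simp
  obtain ⟨a, h1, h2, h3⟩ := weights (T.map (Function.Embedding.subtype _))
  refine ⟨_, a, ?_, h1, ?_, h3⟩
  · intro i hi
    simp only [Finset.coe_map, mem_image] at hi
    obtain ⟨j, -, rfl⟩ := hi
    exact j.2
  · rw [h2, ← hTun]; exact hT

/-- The numerical estimate behind the Frostman bound for a subdivision. -/
lemma mass_le_of_scale {a f M r W C s s' β₁ : ℝ} {c d : ℕ} (hc : 2 ≤ c) (ha : 0 < a) (ha1 : a ≤ 1)
    (hs : 0 < s) (hss : s < s') (hsβ : s' ≤ β₁) (hf : f ≤ (s' - s) / (2 * (1 + s')))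
    (hM : a ^ f ≤ M) (hr : 0 < r) (hr2 : r ≤ 2 * a) (hC : 1 ≤ C)
    (hsmall : 4 * 3 ^ d * C * (48 * c) ^ s' * 2 ^ (s' - s) * a ^ ((s' - s) / 2) ≤ 1)
    (hf0 : 0 ≤ f)
    (hW : W ≤ 1) (h : (c * (24 * r) / a ≤ 1 ∧ W ≤ 4 / M * (3 ^ d * (C * (c * (24 * r) / a) ^ β₁))) ∨
      a ^ (1 + f) ≤ 24 * r) : W ≤ r ^ s / (2 * a) ^ s' := by
  have hs' : 0 < s' := hs.trans hss
  have hcR : (2 : ℝ) ≤ c := by exact_mod_cast hc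
  have hσ : 0 < s' - s := sub_pos.2 hss
  have hfσ : f * (2 * (1 + s')) ≤ s' - s := (le_div_iff₀ (by positivity)).1 hf
  -- The denominator `2 * (1 + s')` serves both losses: `a ^ (-f)` from the mass of `m^L` and `a ^
  -- (-f * s')` from the waiting time `n_L`.
  have hf1 : f ≤ (s' - s) / 2 := by nlinarith
  have hf2 : f * s' ≤ (s' - s) / 2 := by nlinarith
  have hM0 : 0 < M := (Real.rpow_pos_of_pos ha f).trans_le hM
  have ha2 : 0 < (2 * a) ^ s' := by positivity
  have h3d : (1 : ℝ) ≤ 3 ^ d := one_le_pow₀ (by norm_num)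
  have hA : 0 ≤ 4 * 3 ^ d * C * (48 * c : ℝ) ^ s' := by positivity
  -- Both alternatives lead to the exponent `s'` with a loss `a ^ (-(s' - s) / 2)`. Since `r ≤ 2a`,
  -- replacing `s'` by `s` gains `(2a) ^ (s' - s)`, which pays for the loss and for the constants.
  have key : W ≤ 4 * 3 ^ d * C * (48 * c) ^ s' * (r ^ s' * a ^ (-((s' - s) / 2))) / (2 * a) ^ s' := by
    rcases h with ⟨h1, h2⟩ | h1
    · have e1 : (c * (24 * r) / a) ^ β₁ ≤ (c * (24 * r) / a) ^ s' :=
        Real.rpow_le_rpow_of_exponent_ge (by positivity) h1 hsβ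
      have e2 : (c * (24 * r) / a) ^ s' = (48 * c) ^ s' * r ^ s' / (2 * a) ^ s' := by
        rw [← Real.mul_rpow (by positivity) hr.le, ← Real.div_rpow (by positivity) (by positivity)]
        congr 1
        field_simp
        norm_num
      have e3 : 1 / M ≤ a ^ (-((s' - s) / 2)) := by
        rw [Real.rpow_neg ha.le, one_div]
        refine inv_anti₀ (Real.rpow_pos_of_pos ha _) (le_trans ?_ hM)
        exact Real.rpow_le_rpow_of_exponent_ge ha ha1 hf1
      calc W ≤ 4 / M * (3 ^ d * (C * (c * (24 * r) / a) ^ β₁)) := h2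
        _ ≤ 4 / M * (3 ^ d * (C * ((48 * c) ^ s' * r ^ s' / (2 * a) ^ s'))) := by
            rw [← e2]; gcongr
        _ = 4 * 3 ^ d * C * (48 * c) ^ s' * (r ^ s' * (1 / M)) / (2 * a) ^ s' := by ring
        _ ≤ _ := by gcongr
    · have e1 : 1 ≤ (24 * r / a ^ (1 + f)) ^ s' := by
        refine Real.one_le_rpow ?_ hs'.le
        rwa [le_div_iff₀ (by positivity), one_mul]
      have e2 : (24 * r / a ^ (1 + f)) ^ s' = 48 ^ s' * (r ^ s' * a ^ (-(f * s'))) / (2 * a) ^ s' := by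
        rw [Real.rpow_neg ha.le, Real.rpow_mul ha.le, ← Real.inv_rpow (by positivity),
          ← Real.mul_rpow (by positivity) (by positivity),
          ← Real.mul_rpow (by positivity) (by positivity), ← Real.div_rpow (by positivity)
            (by positivity)]
        congr 1
        rw [Real.rpow_add ha, Real.rpow_one]
        field_simp
        norm_num
      have e3 : (48 : ℝ) ^ s' ≤ 4 * 3 ^ d * C * (48 * c) ^ s' := by
        have e4 : (48 : ℝ) ^ s' ≤ (48 * c) ^ s' :=
          Real.rpow_le_rpow (by norm_num) (by linarith) hs'.le
        have e5 : 1 ≤ 4 * 3 ^ d * C := by nlinarith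
        exact e4.trans (le_mul_of_one_le_left (by positivity) e5)
      have e4 : a ^ (-(f * s')) ≤ a ^ (-((s' - s) / 2)) :=
        Real.rpow_le_rpow_of_exponent_ge ha ha1 (by linarith)
      calc W ≤ (24 * r / a ^ (1 + f)) ^ s' := hW.trans e1
        _ = 48 ^ s' * (r ^ s' * a ^ (-(f * s'))) / (2 * a) ^ s' := e2
        _ ≤ _ := by gcongr
  refine key.trans (div_le_div_of_nonneg_right ?_ ha2.le)
  have e1 : r ^ s' ≤ r ^ s * (2 ^ (s' - s) * a ^ (s' - s)) := by
    rw [← Real.mul_rpow (by norm_num) ha.le]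
    calc r ^ s' = r ^ s * r ^ (s' - s) := by rw [← Real.rpow_add hr]; congr 1; ring
      _ ≤ _ := by gcongr
  have e2 : a ^ (s' - s) * a ^ (-((s' - s) / 2)) = a ^ ((s' - s) / 2) := by
    rw [← Real.rpow_add ha]; congr 1; ring
  have hrs : 0 < r ^ s := Real.rpow_pos_of_pos hr _
  calc 4 * 3 ^ d * C * (48 * c : ℝ) ^ s' * (r ^ s' * a ^ (-((s' - s) / 2)))
      ≤ 4 * 3 ^ d * C * (48 * c) ^ s' *
        ((r ^ s * (2 ^ (s' - s) * a ^ (s' - s))) * a ^ (-((s' - s) / 2))) := by gcongr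
    _ = (4 * 3 ^ d * C * (48 * c) ^ s' * 2 ^ (s' - s) * (a ^ (s' - s) * a ^ (-((s' - s) / 2)))) *
        r ^ s := by ring
    _ ≤ 1 * r ^ s := by rw [e2]; exact mul_le_mul_of_nonneg_right hsmall hrs.le
    _ = r ^ s := one_mul _

/-! ### Good boxes and one step of the Cantor construction. -/

section LowerBound

variable {d c : ℕ} {φ ψ : ℝ → ℝ} {μ m : Measure (Fin d → ℝ)} {α β : ℝ} {x : ℕ → Fin d → ℝ}
  {lam : ℕ → ℝ} {D : Set ℝ} {mL : ℕ → (Fin d → ℕ) → Measure (Fin d → ℝ)}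

/-- The lower corner of a box, for boxes indexed by pairs. -/
noncomputable def boxCenter (c : ℕ) (p : ℕ × (Fin d → ℕ)) : Fin d → ℝ := corner c p.1 p.2

/-- Twice the side of a box, for boxes indexed by pairs. -/
noncomputable def boxRadius (d c : ℕ) (p : ℕ × (Fin d → ℕ)) : ℝ := 2 * side c p.1

/-- The boxes `L` of side at most `r₀` with a growth control on `m^L`. -/
structure IsGoodBox (c : ℕ) (β : ℝ) (φ : ℝ → ℝ) (mL : ℕ → (Fin d → ℕ) → Measure (Fin d → ℝ))
    (r₀ : ℝ) (p : ℕ × (Fin d → ℕ)) : Prop where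
  index : IsIndex c p.1 p.2
  growth : (growthIndex c β φ (mL p.1 p.2) p.1 p.2 : ℝ) ≤ p.1 * φ (side c p.1)
  mass : side c p.1 ^ φ (side c p.1) ≤ (mL p.1 p.2).real univ
  small : side c p.1 ≤ r₀

/-- The index `n` and the box `p` are a good choice at the point `y`, at scale `η`. -/
structure IsGoodChoice (c : ℕ) (β : ℝ) (φ : ℝ → ℝ)
    (mL : ℕ → (Fin d → ℕ) → Measure (Fin d → ℝ)) (x : ℕ → Fin d → ℝ) (lam : ℕ → ℝ) (P : ℕ → Prop)
    (δ η : ℝ) (N : ℕ) (y : Fin d → ℝ) (n : ℕ) (p : ℕ × (Fin d → ℕ)) : Prop where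
  le_index : N ≤ n
  lam_le : lam n ≤ η
  cond : P n
  mem : y ∈ Metric.closedBall (x n) (lam n / 2)
  maximal : IsMaximalBox c (Metric.closedBall (x n) (lam n ^ δ)) p.1 p.2
  growth : (growthIndex c β φ (mL p.1 p.2) p.1 p.2 : ℝ) ≤ p.1 * φ (side c p.1)
  mass : side c p.1 ^ φ (side c p.1) ≤ (mL p.1 p.2).real univ

/-- The growth control occurs at arbitrarily small scales. Asking for `lam n < lam N` forces `n ≥ N`
by monotonicity, and smallness below the scale attached to `y` yields `P n`. -/
lemma IsHeterogeneousUbiquitousWith.ae_exists_goodChoice (hc : 2 ≤ c)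
    (H : IsHeterogeneousUbiquitousWith c μ α β x lam D φ ψ m mL) (hpos : ∀ n, 0 < lam n)
    (hanti : Antitone lam) {P : ℕ → Prop}
    (hP : ∀ᵐ y ∂m, y ∈ unitBox d → ∃ η > 0, ∀ n, lam n ≤ η →
      y ∈ Metric.closedBall (x n) (lam n / 2) → P n) {δ : ℝ} (hδ : δ ∈ D) :
    ∀ᵐ y ∂m, y ∈ unitBox d → ∀ η > 0, ∀ N, ∃ n p,
      IsGoodChoice c β φ mL x lam P δ η N y n p := by
  filter_upwards [H.covered, H.growth δ hδ, hP] with y h1 h2 h3 hyu η hη N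
  obtain ⟨η', hη', h4⟩ := h3 hyu
  have hlN := hpos N
  have h5 : ∀ᶠ j in atTop, side c j < min (min η η') (lam N) :=
    (tendsto_side hc).eventually_lt_const (lt_min (lt_min hη hη') hlN)
  obtain ⟨j₀, hj₀⟩ := eventually_atTop.1 h5
  obtain ⟨j, hj, n, hyn, -, hlam, J, K, hmax, hg, hm⟩ := h2 h1 j₀
  have h6 := hlam.trans_lt (hj₀ j hj)
  have h7 : lam n < lam N := h6.trans_le (min_le_right _ _)
  have h8 : lam n < min η η' := h6.trans_le (min_le_left _ _)
  refine ⟨n, (J, K), ?_, h8.le.trans (min_le_left _ _),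
    h4 n (h8.le.trans (min_le_right _ _)) hyn, hyn, hmax, hg, hm⟩
  by_contra hcon
  exact absurd (hanti (not_le.1 hcon).le) (not_le.2 h7)

variable {P : ℕ → Prop} {δ δ₁ η : ℝ} {N n : ℕ} {y : Fin d → ℝ} {p : ℕ × (Fin d → ℕ)}

lemma IsGoodChoice.side_le (hc : 2 ≤ c) (hd : 0 < d)
    (h : IsGoodChoice c β φ mL x lam P δ η N y n p) : side c p.1 ≤ 2 * lam n ^ δ :=
  side_le_of_box_subset hc hd h.maximal.2.1

/-- The constant is `1 + 4`: the corner is within `lam n ^ δ` of `x n`, and the radius is twice a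
side of at most `2 * lam n ^ δ`. -/
lemma IsGoodChoice.closedBall_subset (hc : 2 ≤ c) (hd : 0 < d)
    (h : IsGoodChoice c β φ mL x lam P δ η N y n p) :
    Metric.closedBall (boxCenter c p) (boxRadius d c p) ⊆
      Metric.closedBall (x n) (5 * lam n ^ δ) := by
  refine Metric.closedBall_subset_closedBall' ?_
  have h1 := h.side_le hc hd
  have h2 := Metric.mem_closedBall.1 (h.maximal.2.1 (corner_mem_box hc p.1 p.2))
  simp only [boxCenter, boxRadius]
  linarith

lemma IsGoodChoice.closedBall_subset' (hc : 2 ≤ c) (hd : 0 < d)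
    (h : IsGoodChoice c β φ mL x lam P δ η N y n p) (h10 : 10 * lam n ^ δ ≤ lam n) :
    Metric.closedBall (boxCenter c p) (boxRadius d c p) ⊆ Metric.closedBall y (lam n) := by
  refine (h.closedBall_subset hc hd).trans (Metric.closedBall_subset_closedBall' ?_)
  have h1 := Metric.mem_closedBall'.1 h.mem
  linarith

/-- Good boxes of small side can be subdivided into good boxes which are much smaller. -/
lemma IsHeterogeneousUbiquitousWith.exists_subdivision (hc : 2 ≤ c) (hd : 0 < d)
    (H : IsHeterogeneousUbiquitousWith c μ α β x lam D φ ψ m mL)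
    (hx : ∀ n, x n ∈ Icc (0 : Fin d → ℝ) 1) (hpos : ∀ n, 0 < lam n)
    (hanti : Antitone lam)
    (hP : ∀ᵐ y ∂m, y ∈ unitBox d → ∃ η > 0, ∀ n, lam n ≤ η →
      y ∈ Metric.closedBall (x n) (lam n / 2) → P n)
    (hδ : δ ∈ D) (hδ₁ : δ₁ < δ) {s s' β₁ C r₀ : ℝ} (hs : 0 < s) (hss : s < s')
    (hδs : δ * s' < β₁) (hC : 1 ≤ C)
    (hCφ : ∀ t, 0 < t → t ≤ 1 → t ^ (β - φ t) ≤ C * t ^ β₁) (hr₀ : 0 < r₀) (hr₀' : r₀ ≤ 1 / 2)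
    (hr₀φ : ∀ a, 0 < a → a ≤ r₀ → φ a ≤ (s' - s) / (2 * (1 + s')))
    (hr₀C : ∀ a, 0 < a → a ≤ r₀ →
      4 * 3 ^ d * C * (48 * c) ^ s' * 2 ^ (s' - s) * a ^ ((s' - s) / 2) ≤ 1)
    (N : ℕ) {q : ℕ × (Fin d → ℕ)} (hq : IsGoodBox c β φ mL r₀ q) :
    ∃ F v, IsSubdivision (boxCenter c) (boxRadius d c) (IsGoodBox c β φ mL r₀) s s' q F v ∧
      ∀ p ∈ F, boxRadius d c p < 1 / ((N : ℝ) + 1) ∧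
        Metric.closedBall (boxCenter c p) (boxRadius d c p) ⊆
          {y | ∃ n, N ≤ n ∧ P n ∧ y ∈ Metric.closedBall (x n) (lam n ^ δ₁)} := by
  classical
  obtain ⟨J, K⟩ := q
  have hK : IsIndex c J K := hq.index
  have hfin := H.finite_mL J K hK
  have hδ1 : 1 < δ := H.subset_D hδ
  have hs' : 0 < s' := hs.trans hss
  have hβ₁ : 0 < β₁ := (mul_pos (one_pos.trans hδ1) hs').trans hδs
  have hsβ : s' ≤ β₁ := by nlinarith
  have hcR : (2 : ℝ) ≤ c := by exact_mod_cast hc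
  set a := side c J with ha
  have ha0 : 0 < a := side_pos hc J
  have ha1 : a ≤ 1 := side_le_one hc J
  set M := (mL J K).real univ with hM
  have hMa : a ^ φ a ≤ M := hq.mass
  have hM0 : 0 < M := (Real.rpow_pos_of_pos ha0 _).trans_le hMa
  obtain ⟨hn1, hhalf⟩ := H.half_le_growthSet hc hK
  have hgr : (growthIndex c β φ (mL J K) J K : ℝ) ≤ J * φ a := hq.growth
  set n₀ := growthIndex c β φ (mL J K) J K with hn₀
  set A : ℝ := 4 / M * (3 ^ d * (C * (20 * c / a) ^ β₁)) * (c : ℝ) ^ s' with hA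
  -- How small λ must be: new balls stay inside the parent ball, new boxes are good, the radius
  -- `20λ` is in the range of the growth set, radii are below `1 / (N + 1)`, new balls fit in `B(y,
  -- λ)` and in `B(x_n, λ^δ₁)`, and the masses satisfy the exponent `s'` (possible because `δ * s' <
  -- β₁`).
  have hev : ∀ᶠ l in 𝓝[>] (0 : ℝ), l < min (min a r₀) (min (side c (n₀ + J) / 20)
      (1 / ((N : ℝ) + 1))) ∧ 10 * l ^ δ ≤ l ^ (1 : ℝ) ∧ 5 * l ^ δ ≤ l ^ δ₁ ∧
      A * l ^ β₁ ≤ l ^ (δ * s') := by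
    have h1 : 0 < min (min a r₀) (min (side c (n₀ + J) / 20) (1 / ((N : ℝ) + 1))) := by
      have := side_pos hc (n₀ + J)
      refine lt_min (lt_min ha0 hr₀) (lt_min (by positivity) (by positivity))
    exact (eventually_nhdsWithin_of_eventually_nhds (eventually_lt_nhds h1)).and ((eventually_mul_rpow_le 10 hδ1).and
      ((eventually_mul_rpow_le 5 hδ₁).and (eventually_mul_rpow_le A hδs)))
  obtain ⟨η', hη', hsub⟩ := mem_nhdsGT_iff_exists_Ioo_subset.1 hev
  have hη'0 : (0 : ℝ) < η' := hη'
  have hη2 : 0 < η' / 2 := half_pos hη'0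
  have hscale : ∀ n, lam n ≤ η' / 2 → lam n < min (min a r₀) (min (side c (n₀ + J) / 20)
      (1 / ((N : ℝ) + 1))) ∧ 10 * lam n ^ δ ≤ lam n ^ (1 : ℝ) ∧ 5 * lam n ^ δ ≤ lam n ^ δ₁ ∧
      A * lam n ^ β₁ ≤ lam n ^ (δ * s') := fun n hn => hsub ⟨hpos n, by linarith⟩
  simp only [lt_min_iff, Real.rpow_one] at hscale
  set E := {y | y ∈ growthSet c β φ (mL J K) J K n₀ ∧ ∃ n p,
    IsGoodChoice c β φ mL x lam P δ (η' / 2) N y n p} with hE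
  have hEM : M / 4 < (mL J K).real E := by
    have h1 : ∀ᵐ y ∂(mL J K), y ∈ unitBox d → ∀ η > 0, ∀ N, ∃ n p,
        IsGoodChoice c β φ mL x lam P δ η N y n p :=
      (H.mL_abs J K hK).ae_le
        (ae_restrict_of_ae (H.ae_exists_goodChoice hc hpos hanti hP hδ))
    have h2 : mL J K E = mL J K (growthSet c β φ (mL J K) J K n₀) := by
      refine measure_congr ?_
      filter_upwards [h1] with y hy
      refine propext ⟨fun h => h.1, fun h => ⟨h, hy (box_subset_unitBox hc hK h.1) _ hη2 N⟩⟩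
    rw [measureReal_def, h2, ← measureReal_def]
    linarith
  have hchoice : ∀ y, ∃ n p, y ∈ E → IsGoodChoice c β φ mL x lam P δ (η' / 2) N y n p := by
    intro y
    by_cases hy : y ∈ E
    · obtain ⟨n, p, h⟩ := hy.2
      exact ⟨n, p, fun _ => h⟩
    · exact ⟨0, (0, 0), fun h => (hy h).elim⟩
  choose ν b hνb using hchoice
  -- Disjointness of the balls of radius `4λ` leaves a gap of more than `3λ` around each ball of
  -- radius `λ`; the fivefold enlargements, of radius `20λ`, cover `E`.
  obtain ⟨u, huE, hudisj, hucov⟩ :=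
    Vitali.exists_disjoint_subfamily_covering_enlargement_closedBall E (fun y => y)
      (fun y => 4 * lam (ν y)) (4 * (η' / 2))
      (fun y hy => mul_le_mul_of_nonneg_left (hνb y hy).lam_le (by norm_num)) 5 (by norm_num)
  have hucount : u.Countable := hudisj.countable_of_nonempty_interior fun y _ =>
    ⟨y, mem_interior_iff_mem_nhds.2 (Metric.closedBall_mem_nhds y (by
      have := hpos (ν y); positivity))⟩
  have hEu : E ⊆ ⋃ y ∈ u, Metric.closedBall y (20 * lam (ν y)) := by
    intro y hy
    obtain ⟨w, hw, hyw⟩ := hucov y hy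
    refine mem_iUnion₂.2 ⟨w, hw, ?_⟩
    have h1 : y ∈ Metric.closedBall w (5 * (4 * lam (ν w))) :=
      hyw (Metric.mem_closedBall_self (by have := hpos (ν y); positivity))
    rwa [show 5 * (4 * lam (ν w)) = 20 * lam (ν w) by ring] at h1
  obtain ⟨T, wt, hTu, hwt0, hwtM, hwtsub⟩ := exists_finset_weights (mL J K) hucount
    (U := fun y => Metric.closedBall y (20 * lam (ν y)))
    (fun y => Metric.isClosed_closedBall.measurableSet) (hEM.trans_le (measureReal_mono hEu (measure_ne_top _ _)))
  have hTE : ∀ y ∈ T, y ∈ E := fun y hy => huE (hTu hy)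
  set tot := ∑ y ∈ T, wt y with htot
  have htot0 : 0 < tot := (by positivity : 0 < M / 4).trans hwtM
  have hball : ∀ y ∈ T, Metric.closedBall (boxCenter c (b y)) (boxRadius d c (b y)) ⊆
      Metric.closedBall y (lam (ν y)) := fun y hy =>
    (hνb y (hTE y hy)).closedBall_subset' hc hd (hscale _ (hνb y (hTE y hy)).lam_le).2.1
  have hrad : ∀ y ∈ T, 2 * boxRadius d c (b y) ≤ lam (ν y) := by
    intro y hy
    have h1 := (hνb y (hTE y hy)).side_le hc hd
    have h2 := (hscale _ (hνb y (hTE y hy)).lam_le).2.1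
    have h3 : 0 < lam (ν y) ^ δ := Real.rpow_pos_of_pos (hpos _) _
    simp only [boxRadius]
    linarith
  have hsep : ∀ y ∈ T, ∀ w ∈ T, y ≠ w → ∀ p' ∈ Metric.closedBall y (lam (ν y)),
      ∀ q' ∈ Metric.closedBall w (lam (ν w)), 3 * lam (ν y) < dist p' q' := by
    intro y hy w hw hne p' hp' q' hq'
    have h1 := hudisj (hTu hy) (hTu hw) hne
    have h2 : q' ∈ Metric.closedBall w (4 * lam (ν w)) :=
      Metric.closedBall_subset_closedBall (by have := hpos (ν w); linarith) hq'
    have h3 : q' ∉ Metric.closedBall y (4 * lam (ν y)) := fun h => disjoint_left.1 h1 h h2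
    rw [Metric.mem_closedBall, not_le] at h3
    have h4 := Metric.mem_closedBall.1 hp'
    have h5 := dist_triangle_left q' y p'
    rw [dist_comm p' q'] at h5
    rw [dist_comm p' q']
    linarith
  have hrpos : ∀ p : ℕ × (Fin d → ℕ), 0 < boxRadius d c p := fun p =>
    mul_pos two_pos (side_pos hc _)
  -- Distinct selected points have distinct boxes, so weights on points become weights on boxes
  -- without merging.
  have hinj : ∀ y ∈ T, ∀ w ∈ T, b y = b w → y = w := by
    intro y hy w hw hbw
    by_contra hne
    have h1 := hball y hy (Metric.mem_closedBall_self (hrpos _).le)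
    have h2 := hball w hw (Metric.mem_closedBall_self (hrpos _).le)
    have h3 := hsep y hy w hw hne _ h1 _ h2
    rw [hbw, dist_self] at h3
    have := hpos (ν y)
    linarith
  set v : ℕ × (Fin d → ℕ) → ℝ := fun p => (∑ y ∈ T with b y = p, wt y) / tot with hv
  have hvb : ∀ y ∈ T, v (b y) = wt y / tot := by
    intro y hy
    have h1 : T.filter (fun w => b w = b y) = {y} := by
      ext w
      simp only [Finset.mem_filter, Finset.mem_singleton]
      exact ⟨fun h => hinj w h.1 y hy h.2, fun h => by subst h; exact ⟨hy, rfl⟩⟩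
    simp only [hv, h1, Finset.sum_singleton]
  have hsum : ∀ Q : ℕ × (Fin d → ℕ) → Prop, ∑ p ∈ (T.image b) with Q p, v p =
      (∑ y ∈ T with Q (b y), wt y) / tot := by
    intro Q
    rw [Finset.filter_image, Finset.sum_image, Finset.sum_div]
    · exact Finset.sum_congr rfl fun y hy => hvb y (Finset.mem_filter.1 hy).1
    · intro y hy w hw h
      exact hinj y (Finset.mem_filter.1 hy).1 w (Finset.mem_filter.1 hw).1 h
  have hvtot : ∑ p ∈ T.image b, v p = 1 := by
    have := hsum fun _ => True
    simp only [Finset.filter_true] at this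
    rw [this, div_self htot0.ne']
  -- Normalisation costs at most `4 / M`, since the selected weights exceed a quarter of the mass of
  -- `m^L`.
  have hdivM : ∀ {t : ℝ}, 0 ≤ t → t / tot ≤ 4 / M * t := by
    intro t ht
    rw [div_mul_eq_mul_div, div_le_div_iff₀ htot0 hM0]
    nlinarith
  have hmass : ∀ p ∈ T.image b, v p ≤ boxRadius d c p ^ s' := by
    intro p hp
    obtain ⟨y, hy, rfl⟩ := Finset.mem_image.1 hp
    have hch := hνb y (hTE y hy)
    have hl := hpos (ν y)
    obtain ⟨⟨-, h20, -⟩, -, -, hAl⟩ := hscale _ hch.lam_le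
    have h1 : wt y ≤ (mL J K).real (Metric.closedBall y (20 * lam (ν y))) := by
      have := hwtsub {y} (Finset.singleton_subset_iff.2 hy)
      simpa using this
    have h2 := H.mL_closedBall_le hc hK hC hβ₁ hCφ (hTE y hy).1 (R := 20 * lam (ν y))
      (by positivity) (by linarith)
    have hlδ : lam (ν y) ≤ 1 := by
      have := (hscale _ hch.lam_le).1.1.1
      linarith
    have h3 : lam (ν y) ^ δ ≤ c * side c (b y).1 :=
      hch.maximal.le_side hc (hx _) (Real.rpow_pos_of_pos hl _)
        (Real.rpow_le_one hl.le hlδ (by linarith))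
    rw [hvb y hy]
    have hcs : (0 : ℝ) < (c : ℝ) ^ s' := by positivity
    calc wt y / tot ≤ 4 / M * wt y := hdivM (hwt0 y)
      _ ≤ 4 / M * (3 ^ d * (C * (c * (20 * lam (ν y)) / side c J) ^ β₁)) :=
          mul_le_mul_of_nonneg_left (h1.trans h2) (by positivity)
      _ = A * lam (ν y) ^ β₁ / (c : ℝ) ^ s' := by
          rw [show (c : ℝ) * (20 * lam (ν y)) / side c J = 20 * c / a * lam (ν y) by
            rw [ha]; ring, Real.mul_rpow (by positivity) hl.le, hA]
          field_simp
      _ ≤ lam (ν y) ^ (δ * s') / (c : ℝ) ^ s' := div_le_div_of_nonneg_right hAl hcs.le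
      _ = (lam (ν y) ^ δ / c) ^ s' := by
          rw [Real.div_rpow (by positivity) (by positivity), Real.rpow_mul hl.le]
      _ ≤ boxRadius d c (b y) ^ s' := by
          refine Real.rpow_le_rpow (by positivity) ?_ hs'.le
          have h4 := side_pos hc (b y).1
          rw [div_le_iff₀ (by positivity)]
          simp only [boxRadius]
          nlinarith
  refine ⟨T.image b, v, ⟨?_, ?_, hvtot, ?_, ?_, ?_, ?_, ?_⟩, ?_⟩
  · intro p hp
    obtain ⟨y, hy, rfl⟩ := Finset.mem_image.1 hp
    have hch := hνb y (hTE y hy)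
    refine ⟨hch.maximal.1, hch.growth, hch.mass, ?_⟩
    have h1 := hrad y hy
    have h2 := (hscale _ hch.lam_le).1.1.2
    have h3 := side_pos hc (b y).1
    simp only [boxRadius] at h1
    linarith
  · exact fun p => div_nonneg (Finset.sum_nonneg fun y _ => hwt0 y) htot0.le
  · intro p hp q hq hne p' hp' q' hq'
    obtain ⟨y, hy, rfl⟩ := Finset.mem_image.1 hp
    obtain ⟨w, hw, rfl⟩ := Finset.mem_image.1 hq
    have h1 := hsep y hy w hw (fun h => hne (by rw [h])) p' (hball y hy hp') q' (hball w hw hq')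
    have h2 := hrad y hy
    have := hpos (ν y)
    linarith
  · intro p hp
    obtain ⟨y, hy, rfl⟩ := Finset.mem_image.1 hp
    refine (hball y hy).trans (Metric.closedBall_subset_closedBall' ?_)
    have h1 := (hscale _ (hνb y (hTE y hy)).lam_le).1.1.1
    have h2 := box_subset_closedBall_of_mem hc (corner_mem_box hc J K) (hTE y hy).1.1
    rw [Metric.mem_closedBall] at h2
    simp only [boxCenter, boxRadius]
    linarith
  · intro p hp
    obtain ⟨y, hy, rfl⟩ := Finset.mem_image.1 hp
    have h1 := hrad y hy
    have h2 := (hscale _ (hνb y (hTE y hy)).lam_le).1.1.1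
    have h3 := hrpos (b y)
    have h4 : boxRadius d c (J, K) = 2 * a := rfl
    linarith
  · exact hmass
  · intro x' r hr hrq hsmall
    have hrq' : r ≤ 2 * a := hrq
    have ha12 : a ≤ 1 / 2 := hq.small.trans hr₀'
    set S := T.filter fun y => (Metric.closedBall (boxCenter c (b y)) (boxRadius d c (b y)) ∩
      Metric.closedBall x' r).Nonempty with hS
    have hhit : hitMass (boxCenter c) (boxRadius d c) (T.image b) v x' r = (∑ y ∈ S, wt y) / tot :=
      hsum _
    have hST : S ⊆ T := Finset.filter_subset _ _
    have hrhs : 0 ≤ r ^ s / boxRadius d c (J, K) ^ s' :=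
      div_nonneg (Real.rpow_nonneg hr.le _) (Real.rpow_nonneg (hrpos _).le _)
    -- A single hit box is handled by its own mass bound, as its radius is at most `r` and `2a ≤ 1`.
    -- With two hit boxes, separation bounds the radii `lam (ν y)` by `r`.
    rcases lt_or_ge 1 S.card with hcard | hcard
    swap
    · rcases Nat.le_one_iff_eq_zero_or_eq_one.1 hcard with h0 | h1
      · rw [hhit, Finset.card_eq_zero.1 h0, Finset.sum_empty, zero_div]
        exact hrhs
      · obtain ⟨y, hy⟩ := Finset.card_eq_one.1 h1
        have hyS : y ∈ S := by rw [hy]; exact Finset.mem_singleton_self y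
        obtain ⟨hyT, hmeet⟩ := Finset.mem_filter.1 hyS
        rw [hhit, hy, Finset.sum_singleton, ← hvb y hyT]
        have hbT := Finset.mem_image_of_mem b hyT
        calc v (b y) ≤ boxRadius d c (b y) ^ s' := hmass _ hbT
          _ ≤ r ^ s' := Real.rpow_le_rpow (hrpos _).le (hsmall _ hbT hmeet) hs'.le
          _ ≤ r ^ s := Real.rpow_le_rpow_of_exponent_ge hr (by linarith) hss.le
          _ ≤ r ^ s / boxRadius d c (J, K) ^ s' := by
              rw [le_div_iff₀ (Real.rpow_pos_of_pos (hrpos _) _)]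
              refine mul_le_of_le_one_right (Real.rpow_nonneg hr.le _) ?_
              refine Real.rpow_le_one (hrpos _).le ?_ hs'.le
              change 2 * a ≤ 1
              linarith
    have hle1 : hitMass (boxCenter c) (boxRadius d c) (T.image b) v x' r ≤ 1 := by
      rw [← hvtot]
      exact Finset.sum_le_sum_of_subset_of_nonneg (Finset.filter_subset _ _) fun p _ _ =>
        div_nonneg (Finset.sum_nonneg fun y _ => hwt0 y) htot0.le
    refine mass_le_of_scale hc ha0 ha1 hs hss hsβ (hr₀φ a ha0 hq.small) hMa hr hrq' hC
      (hr₀C a ha0 hq.small) (H.gauges.phi_nonneg ha0.le) hle1 ?_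
    have hlamr : ∀ y ∈ S, lam (ν y) ≤ r := by
      intro y hy
      obtain ⟨w, hw, hwy⟩ := Finset.exists_mem_ne hcard y
      obtain ⟨hyT, p', hp', hp'r⟩ := Finset.mem_filter.1 hy
      obtain ⟨hwT, q', hq', hq'r⟩ := Finset.mem_filter.1 hw
      have h1 := hsep y hyT w hwT hwy.symm p' (hball y hyT hp') q' (hball w hwT hq')
      have h2 := dist_triangle_right p' q' x'
      rw [Metric.mem_closedBall] at hp'r hq'r
      have := hpos (ν y)
      linarith
    have hdist : ∀ y ∈ S, dist y x' ≤ lam (ν y) + r := by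
      intro y hy
      obtain ⟨hyT, p', hp', hp'r⟩ := Finset.mem_filter.1 hy
      have h1 := Metric.mem_closedBall'.1 (hball y hyT hp')
      have h2 := dist_triangle y p' x'
      rw [Metric.mem_closedBall] at hp'r
      linarith
    obtain ⟨y₀, hy₀⟩ : S.Nonempty := Finset.card_pos.1 (by omega)
    -- Hit centres are within `4r` of `y₀` and enlarged radii are at most `20r`, whence `24r`. Below
    -- the scale `c^(-n_L)|L|` the growth set bounds the mass; above it, the trivial bound 1
    -- suffices because `n_L` is small.
    rcases le_or_gt (24 * r) (side c (n₀ + J)) with h24 | h24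
    · left
      have hsub' : (⋃ y ∈ S, Metric.closedBall y (20 * lam (ν y))) ⊆
          Metric.closedBall y₀ (24 * r) := by
        refine iUnion₂_subset fun y hy => Metric.closedBall_subset_closedBall' ?_
        have h1 := hdist y hy
        have h2 := hdist y₀ hy₀
        have h3 := hlamr y hy
        have h4 := hlamr y₀ hy₀
        have h5 := dist_triangle_right y y₀ x'
        linarith
      constructor
      · rw [div_le_one ha0]
        -- The requirement `n_L ≥ 1` is what provides the extra generation here.
        calc (c : ℝ) * (24 * r) ≤ c * side c (J + 1) := by
              refine mul_le_mul_of_nonneg_left (h24.trans (side_antitone hc ?_)) (by positivity)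
              omega
          _ = a := side_succ hc J
      · rw [hhit]
        refine (hdivM (Finset.sum_nonneg fun y _ => hwt0 y)).trans
          (mul_le_mul_of_nonneg_left ?_ (by positivity))
        exact (hwtsub S hST).trans ((measureReal_mono hsub').trans
          (H.mL_closedBall_le hc hK hC hβ₁ hCφ (hTE y₀ (hST hy₀)).1 (by positivity) h24))
    · right
      refine le_trans ?_ h24.le
      have hc0 : (0 : ℝ) < c := by linarith
      -- This is `n_L ≤ J φ(|L|)` in exponential form, with `a = c ^ (-J)`.
      have h1 : a ^ φ a ≤ side c n₀ := by
        have h2 : a = (c : ℝ) ^ (-(J : ℝ)) := by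
          rw [ha, side, Real.rpow_neg hc0.le, Real.rpow_natCast]
        have h3 : side c n₀ = (c : ℝ) ^ (-(n₀ : ℝ)) := by
          rw [side, Real.rpow_neg hc0.le, Real.rpow_natCast]
        have h4 : a ^ φ a = (c : ℝ) ^ (-(J : ℝ) * φ a) := by
          rw [Real.rpow_mul hc0.le, ← h2]
        rw [h4, h3]
        exact Real.rpow_le_rpow_of_exponent_le (by linarith) (by linarith)
      rw [Real.rpow_add ha0, Real.rpow_one, side_add, mul_comm]
      exact mul_le_mul_of_nonneg_right h1 ha0.le
  · intro p hp
    obtain ⟨y, hy, rfl⟩ := Finset.mem_image.1 hp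
    have hch := hνb y (hTE y hy)
    obtain ⟨⟨-, -, hN⟩, -, h5, -⟩ := hscale _ hch.lam_le
    constructor
    · have h1 := hrad y hy
      have h3 := hrpos (b y)
      linarith
    · intro w hw
      refine ⟨ν y, hch.le_index, hch.cond, ?_⟩
      exact Metric.closedBall_subset_closedBall h5 (hch.closedBall_subset hc hd hw)

end LowerBound
-- The lower bound for the dimension.
section LowerBoundDimension

variable {d c : ℕ} {φ ψ : ℝ → ℝ} {μ m : Measure (Fin d → ℝ)} {α β : ℝ} {x : ℕ → Fin d → ℝ}
  {lam : ℕ → ℝ} {D : Set ℝ} {mL : ℕ → (Fin d → ℕ) → Measure (Fin d → ℝ)}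

lemma IsHeterogeneousUbiquitousWith.dim_pos
    (H : IsHeterogeneousUbiquitousWith c μ α β x lam D φ ψ m mL) : 0 < d := by
  have h1 := H.beta_pos
  have h2 := H.beta_le
  exact_mod_cast h1.trans_le h2

/-- Full support of `m` in the cube: a property valid almost everywhere occurs in the interior of
every box. -/
lemma IsHeterogeneousUbiquitousWith.exists_mem_of_ae (hc : 2 ≤ c)
    (H : IsHeterogeneousUbiquitousWith c μ α β x lam D φ ψ m mL) {j : ℕ} {k : Fin d → ℕ}
    (hk : IsIndex c j k) {Q : (Fin d → ℝ) → Prop} (hQ : ∀ᵐ y ∂m, Q y) :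
    ∃ y ∈ interior (box c j k), Q y := by
  by_contra! hcon
  refine (measure_interior_box_pos hc H.support_m hk).ne' (measure_mono_null (fun y hy => ?_) hQ)
  exact hcon y hy

/-- The limsup set of the contracted balls whose index satisfies `P` has dimension at least
`β / δ₁`, when almost every point sees `P` at all small scales. -/
theorem IsHeterogeneousUbiquitousWith.le_dimH (hc : 2 ≤ c)
    (H : IsHeterogeneousUbiquitousWith c μ α β x lam D φ ψ m mL)
    (hD : Ioi 1 ⊆ closure D)
    (hx : ∀ n, x n ∈ Icc (0 : Fin d → ℝ) 1) (hpos : ∀ n, 0 < lam n)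
    (hanti : Antitone lam) {P : ℕ → Prop}
    (hP : ∀ᵐ y ∂m, y ∈ unitBox d → ∃ η > 0, ∀ n, lam n ≤ η →
      y ∈ Metric.closedBall (x n) (lam n / 2) → P n) {δ₁ : ℝ} (hδ₁ : 1 ≤ δ₁) :
    ENNReal.ofReal (β / δ₁) ≤
      dimH {y | ∀ N, ∃ n, N ≤ n ∧ P n ∧ y ∈ Metric.closedBall (x n) (lam n ^ δ₁)} := by
  have hd := H.dim_pos
  have hδ₁0 : 0 < δ₁ := one_pos.trans_le hδ₁
  refine le_of_forall_lt_imp_le_of_dense fun S hS => ?_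
  obtain ⟨s, hs, rfl⟩ : ∃ s : ℝ, 0 ≤ s ∧ S = ENNReal.ofReal s :=
    ⟨S.toReal, ENNReal.toReal_nonneg, (ENNReal.ofReal_toReal hS.ne_top).symm⟩
  have hsβ : s < β / δ₁ := (ENNReal.ofReal_lt_ofReal_iff'.1 hS).1
  rcases hs.eq_or_lt with rfl | hs
  · simp
  have hδ₁s : δ₁ < β / s := by
    rw [lt_div_iff₀ hδ₁0] at hsβ
    rw [lt_div_iff₀ hs]
    linarith
  obtain ⟨t, ht1, ht2⟩ := exists_between hδ₁s
  -- Density of `D` supplies a growth exponent strictly above `δ₁`. The excess absorbs the factor 5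
  -- between the radii, and also covers `δ₁ = 1`, which is not in `D`.
  obtain ⟨δ, ⟨hδ₁δ, hδβ⟩, hδ⟩ := mem_closure_iff.1 (hD (mem_Ioi.2 (hδ₁.trans_lt ht1)))
    (Ioo δ₁ (β / s)) isOpen_Ioo ⟨ht1, ht2⟩
  have hδ0 : 0 < δ := hδ₁0.trans hδ₁δ
  have hδ1 : 1 < δ := H.subset_D hδ
  have hs1 : s < β / δ := by
    rw [lt_div_iff₀ hs] at hδβ
    rw [lt_div_iff₀ hδ0]
    linarith
  obtain ⟨s', hss, hs'β⟩ := exists_between hs1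
  have hs'0 : 0 < s' := hs.trans hss
  rw [lt_div_iff₀ hδ0, mul_comm] at hs'β
  obtain ⟨β₁, hβ₁, hβ₁β⟩ := exists_between hs'β
  have hβ₁0 : 0 < β₁ := (mul_pos hδ0 hs'0).trans hβ₁
  obtain ⟨C, hC, hCφ⟩ := H.gauges.exists_rpow_sub_phi_le hβ₁0 hβ₁β
  have hσ : 0 < s' - s := sub_pos.2 hss
  have hev : ∀ᶠ a in 𝓝[>] (0 : ℝ), φ a < (s' - s) / (2 * (1 + s')) ∧
      4 * 3 ^ d * C * (48 * c) ^ s' * 2 ^ (s' - s) * a ^ ((s' - s) / 2) ≤ a ^ (0 : ℝ) ∧ a < 1 ∧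
      10 * a ^ δ ≤ a ^ (1 : ℝ) :=
    (H.gauges.tendsto_phi_zero.eventually_lt_const (by positivity)).and
      ((eventually_mul_rpow_le _ (by positivity)).and
        ((eventually_nhdsWithin_of_eventually_nhds (eventually_lt_nhds one_pos)).and
          (eventually_mul_rpow_le _ hδ1)))
  obtain ⟨r₁, hr₁, hsub⟩ := mem_nhdsGT_iff_exists_Ioo_subset.1 hev
  have hr₁0 : (0 : ℝ) < r₁ := hr₁
  set r₀ := min (r₁ / 2) (1 / 2) with hr₀
  have hr₀0 : 0 < r₀ := lt_min (half_pos hr₁0) (by norm_num)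
  have hr₀r₁ : r₀ < r₁ := (min_le_left _ _).trans_lt (half_lt_self hr₁0)
  have hsub' : ∀ a, 0 < a → a ≤ r₀ → φ a < (s' - s) / (2 * (1 + s')) ∧
      4 * 3 ^ d * C * (48 * c) ^ s' * 2 ^ (s' - s) * a ^ ((s' - s) / 2) ≤ a ^ (0 : ℝ) ∧ a < 1 ∧
      10 * a ^ δ ≤ a ^ (1 : ℝ) := fun a ha har => hsub ⟨ha, har.trans_lt hr₀r₁⟩
  simp only [Real.rpow_zero, Real.rpow_one] at hsub'
  -- A good choice at one typical point of the unit cube gives the box that starts the construction.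
  have hidx : IsIndex c 0 (fun _ : Fin d => 0) := fun _ => by simp
  obtain ⟨y, hyI, hy⟩ := H.exists_mem_of_ae hc hidx (H.ae_exists_goodChoice hc hpos hanti hP hδ)
  obtain ⟨n, p, hnp⟩ := hy (box_subset_unitBox hc hidx (interior_subset hyI)) r₀ hr₀0 0
  have hp : IsGoodBox c β φ mL r₀ p := by
    refine ⟨hnp.maximal.1, hnp.growth, hnp.mass, ?_⟩
    have h1 := hnp.side_le hc hd
    have h2 := (hsub' (lam n) (hpos n) hnp.lam_le).2.2.2
    have h3 := hnp.lam_le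
    have h4 := Real.rpow_pos_of_pos (hpos n) δ
    linarith
  have key := le_dimH_iInter_of_subdivision (s' := s') hs
    (fun p _ => mul_pos two_pos (side_pos hc p.1))
    (fun N => {y | ∃ n, N ≤ n ∧ P n ∧ y ∈ Metric.closedBall (x n) (lam n ^ δ₁)})
    (fun N q hq => H.exists_subdivision hc hd hx hpos hanti hP hδ hδ₁δ hs hss hβ₁ hC hCφ hr₀0
      (min_le_right _ _) (fun a ha har => (hsub' a ha har).1.le)
      (fun a ha har => (hsub' a ha har).2.1) N hq) hp
  refine key.trans (dimH_mono fun y hy N => ?_)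
  exact mem_iInter.1 hy N

end LowerBoundDimension

/-! ### The upper bound -/

section UpperBound

variable {d c : ℕ} {φ ψ : ℝ → ℝ} {μ m : Measure (Fin d → ℝ)} {α β : ℝ} {x : ℕ → Fin d → ℝ}
  {lam : ℕ → ℝ} {D : Set ℝ} {mL : ℕ → (Fin d → ℕ) → Measure (Fin d → ℝ)}

/-- A typical point of the interior has small boxes inside the given one, and local scaling bounds
their `μ`-mass below. Positivity is needed for moments of negative order. -/
lemma IsHeterogeneousUbiquitousWith.measureReal_box_pos [IsFiniteMeasure μ] (hc : 2 ≤ c)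
    (H : IsHeterogeneousUbiquitousWith c μ α β x lam D φ ψ m mL) {j : ℕ} {k : Fin d → ℕ}
    (hk : IsIndex c j k) : 0 < μ.real (box c j k) := by
  obtain ⟨y, hyI, hy⟩ := H.exists_mem_of_ae hc hk H.scaling
  have hyu := box_subset_unitBox hc hk (interior_subset hyI)
  obtain ⟨j₀, hj₀⟩ := hy hyu
  obtain ⟨r, hr, hball⟩ := Metric.isOpen_iff.1 isOpen_interior y hyI
  obtain ⟨j', h1, h2⟩ := (((tendsto_side hc).eventually_lt_const hr).and
    (eventually_ge_atTop j₀)).exists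
  have h3 := (hj₀ j' h2 _ (isIndex_boxIndex hc j' hyu) (near_refl _)).1
  refine (Real.rpow_pos_of_pos (side_pos hc j') _).trans_le (h3.trans (measureReal_mono ?_))
  exact ((box_subset_closedBall_of_mem hc (mem_box_boxIndex hc j' hyu)).trans
    (Metric.closedBall_subset_ball h1)).trans (hball.trans interior_subset)

/-- The moments of the boxes are controlled, for a suitable exponent, by `τ_μ^*(α)`. -/
lemma exists_moment_bound (hc : 2 ≤ c) (hβ : (β : EReal) = tauStar c μ α) {η : ℝ} (hη : 0 < η) :
    ∃ q : ℝ, ∀ᶠ g in atTop,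
      ∑ k ∈ gridIndices d c g, μ.real (box c g k) ^ q ≤ side c g ^ (α * q - β - η) := by
  have hc1 : (1 : ℝ) < c := by exact_mod_cast (by omega : 1 < c)
  have h1 : tauStar c μ α < ((β + η : ℝ) : EReal) := by
    rw [← hβ]; exact_mod_cast (by linarith : β < β + η)
  obtain ⟨q, hq⟩ := iInf_lt_iff.1 h1
  refine ⟨q, ?_⟩
  -- The value `⊥` is excluded because `α q - ⊥ = ⊤`; the value `⊤` makes the claim trivial.
  have h2 : ((α * q - β - η : ℝ) : EReal) < tau c μ q := by
    induction h : tau c μ q using EReal.rec with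
    | bot => rw [h, EReal.coe_sub_bot] at hq; exact absurd hq not_top_lt
    | top => exact EReal.coe_lt_top _
    | coe t =>
      rw [h] at hq
      have h3 : α * q - t < β + η := by exact_mod_cast hq
      exact_mod_cast (by linarith : α * q - β - η < t)
  filter_upwards [eventually_lt_of_lt_liminf h2, eventually_ge_atTop 1] with g hg hg1
  have h3 : α * q - β - η < -(1 / (g : ℝ)) * Real.logb c
    (∑ k : Fin d → Fin (c ^ g), μ.real (box c g fun i => (k i : ℕ)) ^ q) := by exact_mod_cast hg
  rw [sum_gridIndices fun k => μ.real (box c g k) ^ q] at h3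
  set Z := ∑ k ∈ gridIndices d c g, μ.real (box c g k) ^ q
  have hZ : 0 ≤ Z := Finset.sum_nonneg fun k _ => Real.rpow_nonneg measureReal_nonneg _
  rcases hZ.eq_or_lt with h0 | h0
  · rw [← h0]; exact Real.rpow_nonneg (side_pos hc g).le _
  have hg0 : (0 : ℝ) < g := by exact_mod_cast hg1
  have h4 : Real.logb c Z ≤ -(g : ℝ) * (α * q - β - η) := by
    have h5 : -(1 / (g : ℝ)) * Real.logb c Z = -(Real.logb c Z / g) := by ring
    rw [h5, lt_neg, div_lt_iff₀ hg0] at h3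
    linarith
  have h6 : side c g = (c : ℝ) ^ (-(g : ℝ)) := by
    rw [side, Real.rpow_neg (by linarith), Real.rpow_natCast]
  rw [h6, ← Real.rpow_mul (by linarith)]
  exact (Real.logb_le_iff_le_rpow hc1 h0).1 h4

/-- The moments of a disjoint family of balls are controlled by those of the boxes. -/
lemma exists_sum_ball_moment_le [IsFiniteMeasure μ] (hc : 2 ≤ c) (hμ : μ (unitBox d)ᶜ = 0)
    (hμpos : ∀ j k, IsIndex c j k → 0 < μ.real (box c j k))
    (hx : ∀ n, x n ∈ Icc (0 : Fin d → ℝ) 1) (A : ℕ) (q : ℝ) :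
    ∃ C : ℝ, 0 < C ∧ ∀ (g : ℕ) (S : Finset ℕ),
      (∀ n ∈ S, side c g ≤ lam n ∧ lam n ≤ A * side c g) →
      (∀ n ∈ S, ∀ n' ∈ S, n ≠ n' →
        Disjoint (Metric.closedBall (x n) (lam n)) (Metric.closedBall (x n') (lam n'))) →
      ∑ n ∈ S, μ.real (Metric.closedBall (x n) (lam n)) ^ q ≤
        C * ∑ k ∈ gridIndices d c g, μ.real (box c g k) ^ q := by
  classical
  set E : ℝ := (2 * (A + 1) + 1 : ℕ) ^ d with hE
  have hE1 : 1 ≤ E := one_le_pow₀ (by exact_mod_cast (by omega : 1 ≤ 2 * (A + 1) + 1))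
  have hcard : ∀ l : Fin d → ℕ, ((indexBall (A + 1) l).card : ℝ) ≤ E := fun l => by
    rw [hE]; exact_mod_cast card_indexBall_le (A + 1) l
  refine ⟨max 1 (E ^ q * E), by positivity, fun g S hS hdisj => ?_⟩
  have hbox : ∀ n, ∃ l : Fin d → ℕ, n ∈ S → IsIndex c g l ∧
      box c g l ⊆ Metric.closedBall (x n) (lam n) ∧
      ∀ i, (l i : ℝ) * side c g ≤ x n i ∧ x n i ≤ ((l i : ℝ) + 1) * side c g := by
    intro n
    by_cases hn : n ∈ S
    · obtain ⟨l, hl⟩ := exists_box_subset_closedBall hc (hx n) (hS n hn).1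
      exact ⟨l, fun _ => hl⟩
    · exact ⟨0, fun h => (hn h).elim⟩
  choose l hl using hbox
  have hinj : ∀ n ∈ S, ∀ n' ∈ S, l n = l n' → n = n' := by
    intro n hn n' hn' h
    by_contra hne
    have h1 := (hl n hn).2.1 (corner_mem_box hc g (l n))
    rw [h] at h1
    exact disjoint_left.1 (hdisj n hn n' hn' hne) h1 ((hl n' hn').2.1 (corner_mem_box hc g _))
  have hle : ∀ n ∈ S, μ.real (box c g (l n)) ≤ μ.real (Metric.closedBall (x n) (lam n)) :=
    fun n hn => measureReal_mono (hl n hn).2.1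
  have hZ : 0 ≤ ∑ k ∈ gridIndices d c g, μ.real (box c g k) ^ q :=
    Finset.sum_nonneg fun k _ => Real.rpow_nonneg measureReal_nonneg _
  -- For `q < 0` a box inside each ball has smaller mass, hence a larger power, and disjoint balls
  -- have distinct boxes. For `q ≥ 0` a ball is dominated by the heaviest of boundedly many nearby
  -- boxes, and each box is near boundedly many balls.
  rcases lt_or_ge q 0 with hq | hq
  · calc ∑ n ∈ S, μ.real (Metric.closedBall (x n) (lam n)) ^ q
        ≤ ∑ n ∈ S, μ.real (box c g (l n)) ^ q := Finset.sum_le_sum fun n hn =>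
          Real.rpow_le_rpow_of_nonpos (hμpos g _ (hl n hn).1) (hle n hn) hq.le
      _ = ∑ k ∈ S.image l, μ.real (box c g k) ^ q := (Finset.sum_image
          (f := fun k => μ.real (box c g k) ^ q) fun n hn n' hn' h => hinj n hn n' hn' h).symm
      _ ≤ ∑ k ∈ gridIndices d c g, μ.real (box c g k) ^ q := by
          refine Finset.sum_le_sum_of_subset_of_nonneg (fun k hk => ?_) fun k _ _ =>
            Real.rpow_nonneg measureReal_nonneg _
          obtain ⟨n, hn, rfl⟩ := Finset.mem_image.1 hk
          exact mem_gridIndices.2 (hl n hn).1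
      _ ≤ _ := le_mul_of_one_le_left hZ (le_max_left _ _)
  · have hball : ∀ n ∈ S, μ.real (Metric.closedBall (x n) (lam n)) ^ q ≤
        E ^ q * ∑ k ∈ gridIndices d c g with k ∈ indexBall (A + 1) (l n),
          μ.real (box c g k) ^ q := by
      intro n hn
      set G := (gridIndices d c g).filter (· ∈ indexBall (A + 1) (l n)) with hG
      -- The radius `A + 1` in place of `A` allows for the indices `boxIndex c g (x n)` and `l n`
      -- differing by one.
      have h1 : μ.real (Metric.closedBall (x n) (lam n)) ≤ ∑ k ∈ G, μ.real (box c g k) := by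
        refine (measureReal_closedBall_le_sum hc hμ (hx n).1 (hS n hn).2).trans ?_
        refine Finset.sum_le_sum_of_subset_of_nonneg (fun k hk => ?_) fun k _ _ =>
          measureReal_nonneg
        obtain ⟨hk1, hk2⟩ := Finset.mem_filter.1 hk
        refine Finset.mem_filter.2 ⟨hk1, mem_indexBall.2 fun i => ?_⟩
        have h2 := mem_indexBall.1 hk2 i
        have h3 := (hl n hn).2.2 i
        have h4 := boxIndex_le hc g ((hx n).1 i)
        have h5 := lt_boxIndex hc g (x n) i
        have hs := side_pos hc g
        have h6 : (boxIndex c g (x n) i : ℝ) ≤ l n i + 1 :=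
          le_of_mul_le_mul_right (h4.trans h3.2) hs
        have h7 : (l n i : ℝ) < boxIndex c g (x n) i + 1 :=
          lt_of_mul_lt_mul_right (h3.1.trans_lt h5) hs.le
        have h8 : boxIndex c g (x n) i ≤ l n i + 1 := by exact_mod_cast h6
        have h9 : l n i < boxIndex c g (x n) i + 1 := by exact_mod_cast h7
        omega
      have hGne : G.Nonempty := ⟨l n, Finset.mem_filter.2 ⟨mem_gridIndices.2 (hl n hn).1,
        mem_indexBall.2 fun i => by omega⟩⟩
      obtain ⟨k₀, hk₀, hmax⟩ := G.exists_max_image (fun k => μ.real (box c g k)) hGne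
      have h2 : ∑ k ∈ G, μ.real (box c g k) ≤ E * μ.real (box c g k₀) := by
        refine (Finset.sum_le_card_nsmul _ _ _ hmax).trans ?_
        rw [nsmul_eq_mul]
        refine mul_le_mul_of_nonneg_right ?_ measureReal_nonneg
        refine le_trans ?_ (hcard (l n))
        exact_mod_cast Finset.card_le_card fun k hk => (Finset.mem_filter.1 hk).2
      calc μ.real (Metric.closedBall (x n) (lam n)) ^ q ≤ (E * μ.real (box c g k₀)) ^ q :=
            Real.rpow_le_rpow measureReal_nonneg (h1.trans h2) hq
        _ = E ^ q * μ.real (box c g k₀) ^ q := Real.mul_rpow (by positivity) measureReal_nonneg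
        _ ≤ _ := by
            refine mul_le_mul_of_nonneg_left ?_ (by positivity)
            exact Finset.single_le_sum (f := fun k => μ.real (box c g k) ^ q)
              (fun k _ => Real.rpow_nonneg measureReal_nonneg _) hk₀
    calc ∑ n ∈ S, μ.real (Metric.closedBall (x n) (lam n)) ^ q
        ≤ ∑ n ∈ S, E ^ q * ∑ k ∈ gridIndices d c g with k ∈ indexBall (A + 1) (l n),
          μ.real (box c g k) ^ q := Finset.sum_le_sum hball
      _ = E ^ q * ∑ k ∈ gridIndices d c g,
          ((S.filter fun n => k ∈ indexBall (A + 1) (l n)).card : ℝ) * μ.real (box c g k) ^ q := by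
          rw [← Finset.mul_sum]
          simp only [Finset.sum_filter]
          rw [Finset.sum_comm]
          congr 1
          refine Finset.sum_congr rfl fun k _ => ?_
          rw [← Finset.sum_filter, Finset.sum_const, nsmul_eq_mul]
      _ ≤ E ^ q * ∑ k ∈ gridIndices d c g, E * μ.real (box c g k) ^ q := by
          refine mul_le_mul_of_nonneg_left (Finset.sum_le_sum fun k _ => ?_) (by positivity)
          refine mul_le_mul_of_nonneg_right (le_trans ?_ (hcard k))
            (Real.rpow_nonneg measureReal_nonneg _)
          have h1 : (S.filter fun n => k ∈ indexBall (A + 1) (l n)).card ≤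
              (indexBall (A + 1) k).card := by
            refine Finset.card_le_card_of_injOn l (fun n hn => ?_) fun n hn n' hn' h => ?_
            · have h2 := mem_indexBall.1 (Finset.mem_filter.1 hn).2
              exact mem_indexBall.2 fun i => (h2 i).symm
            · exact hinj n (Finset.mem_filter.1 hn).1 n' (Finset.mem_filter.1 hn').1 h
          exact_mod_cast h1
      _ = E ^ q * E * ∑ k ∈ gridIndices d c g, μ.real (box c g k) ^ q := by
          rw [← Finset.mul_sum, mul_assoc]
      _ ≤ _ := mul_le_mul_of_nonneg_right (le_max_right _ _) hZ

end UpperBound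
-- Summability over the balls of prescribed mass and the upper bound for the dimension.
section UpperBoundDimension

variable {d c : ℕ} {μ : Measure (Fin d → ℝ)} {α β : ℝ} {x : ℕ → Fin d → ℝ} {lam ε : ℕ → ℝ}

/-- The balls of index `n` have the mass prescribed by `α` up to the error `ε n`. -/
def HasScaling (μ : Measure (Fin d → ℝ)) (x : ℕ → Fin d → ℝ) (lam : ℕ → ℝ) (α : ℝ) (ε : ℕ → ℝ)
    (n : ℕ) : Prop :=
  lam n ^ (α + ε n) ≤ μ.real (Metric.closedBall (x n) (lam n)) ∧
    μ.real (Metric.closedBall (x n) (lam n)) ≤ lam n ^ (α - ε n)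

lemma rpow_le_of_comparable {l a B p : ℝ} (ha : 0 < a) (hal : a ≤ l) (hlB : l ≤ B * a)
    (hB : 1 ≤ B) : l ^ p ≤ B ^ |p| * a ^ p := by
  have hl : 0 < l := ha.trans_le hal
  rcases le_or_gt 0 p with hp | hp
  · rw [abs_of_nonneg hp, ← Real.mul_rpow (by linarith) ha.le]
    exact Real.rpow_le_rpow hl.le hlB hp
  · refine (Real.rpow_le_rpow_of_nonpos ha hal hp.le).trans
      (le_mul_of_one_le_left (Real.rpow_nonneg ha.le _) ?_)
    exact Real.one_le_rpow hB (abs_nonneg _)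

/-- Along disjoint balls of the same dyadic class with prescribed mass, the sums of the radii to a
power greater than `τ_μ^*(α)` decay exponentially. -/
lemma exists_sum_disjoint_le [IsFiniteMeasure μ] (hc : 2 ≤ c) (hμ : μ (unitBox d)ᶜ = 0)
    (hμpos : ∀ j k, IsIndex c j k → 0 < μ.real (box c j k))
    (hx : ∀ n, x n ∈ Icc (0 : Fin d → ℝ) 1) (hpos : ∀ n, 0 < lam n) (hanti : Antitone lam)
    (hβ : (β : EReal) = tauStar c μ α) (hε : Tendsto ε atTop (𝓝 0)) {t : ℝ} (ht : β < t) :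
    ∃ κ C : ℝ, 0 < κ ∧ 0 < C ∧ ∃ j₁ : ℕ, ∀ (j : ℕ), j₁ ≤ j → ∀ (S : Finset ℕ),
      (∀ n ∈ S, n ∈ dyadicClass lam j ∧ HasScaling μ x lam α ε n) →
      (∀ n ∈ S, ∀ n' ∈ S, n ≠ n' →
        Disjoint (Metric.closedBall (x n) (lam n)) (Metric.closedBall (x n') (lam n'))) →
      ∑ n ∈ S, lam n ^ t ≤ C * side 2 j ^ κ := by
  have hcR : (2 : ℝ) ≤ c := by exact_mod_cast hc
  -- One third pays for the moment estimate, one for the errors `ε n`, and the last is the decay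
  -- that remains.
  set κ := (t - β) / 3 with hκ
  have hκ0 : 0 < κ := by rw [hκ]; linarith
  obtain ⟨q, hq⟩ := exists_moment_bound hc hβ hκ0
  obtain ⟨g₁, hg₁⟩ := eventually_atTop.1 hq
  obtain ⟨C, hC, hsum⟩ := exists_sum_ball_moment_le (lam := lam) hc hμ hμpos hx (2 * c) q
  set e₀ := κ / (|q| + 1) with he₀
  have hq0 := abs_nonneg q
  have he₀0 : 0 < e₀ := by positivity
  have hqe : |q| * e₀ ≤ κ := by
    rw [he₀, mul_div_assoc', div_le_iff₀ (by positivity)]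
    nlinarith
  obtain ⟨n₁, hn₁⟩ := eventually_atTop.1 (hε.eventually_lt_const he₀0)
  have hev : ∀ᶠ j in atTop, side 2 j < min (lam n₁) (side c g₁) :=
    (tendsto_side le_rfl).eventually_lt_const (lt_min (hpos n₁) (side_pos hc g₁))
  obtain ⟨j₁, hj₁⟩ := eventually_atTop.1 hev
  -- An exponent with `lam n ^ e ≤ μ(B) ^ q` for either sign of `q`: the lower mass bound serves `q
  -- ≥ 0`, the upper one `q < 0`.
  set e := α * q + |q| * e₀ with he
  set B : ℝ := 2 * c with hB
  have hB1 : 1 ≤ B := by rw [hB]; linarith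
  refine ⟨κ, B ^ |t - e| * C, hκ0, by positivity, j₁, fun j hj S hS hdisj => ?_⟩
  have hs2 := side_pos (le_refl 2) (j + 1)
  -- A `c`-adic side `a` just below `2 ^ (-(j + 1))`, so that all radii of the class lie between `a`
  -- and `2ca`.
  obtain ⟨g', h1, h2⟩ := exists_side_near hc hs2 (side_le_one le_rfl _)
  have h2j := side_succ (le_refl 2) j
  have hcg := side_succ hc g'
  push_cast at h2j
  set g := g' + 1 with hg
  set a := side c g with ha
  have ha0 : 0 < a := side_pos hc g
  have ha1 : a ≤ 1 := side_le_one hc g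
  obtain ⟨h3, h4⟩ := lt_min_iff.1 (hj₁ j hj)
  have hgg : g₁ ≤ g := by
    by_contra hcon
    have := side_antitone hc (not_le.1 hcon).le
    linarith
  have hlam : ∀ n ∈ S, a ≤ lam n ∧ lam n ≤ B * a := by
    intro n hn
    obtain ⟨⟨h5, h6⟩, -⟩ := hS n hn
    constructor
    · linarith
    · rw [hB]; linarith
  have hterm : ∀ n ∈ S, lam n ^ t ≤
      B ^ |t - e| * a ^ (t - e) * μ.real (Metric.closedBall (x n) (lam n)) ^ q := by
    intro n hn
    obtain ⟨⟨h5, h6⟩, h7, h8⟩ := hS n hn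
    have hl := hpos n
    have hl1 : lam n ≤ 1 := h6.trans (side_le_one le_rfl j)
    have hnn : n₁ ≤ n := by
      by_contra hcon
      have := hanti (not_le.1 hcon).le
      linarith
    have hεn := (hn₁ n hnn).le
    have hμn : 0 < μ.real (Metric.closedBall (x n) (lam n)) :=
      (Real.rpow_pos_of_pos hl _).trans_le h7
    have h9 : lam n ^ e ≤ μ.real (Metric.closedBall (x n) (lam n)) ^ q := by
      rcases le_or_gt 0 q with hq | hq
      · calc lam n ^ e ≤ lam n ^ ((α + ε n) * q) := by
              refine Real.rpow_le_rpow_of_exponent_ge hl hl1 ?_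
              rw [he, abs_of_nonneg hq]
              nlinarith
          _ = (lam n ^ (α + ε n)) ^ q := Real.rpow_mul hl.le _ _
          _ ≤ _ := Real.rpow_le_rpow (Real.rpow_nonneg hl.le _) h7 hq
      · calc lam n ^ e ≤ lam n ^ ((α - ε n) * q) := by
              refine Real.rpow_le_rpow_of_exponent_ge hl hl1 ?_
              rw [he, abs_of_neg hq]
              nlinarith
          _ = (lam n ^ (α - ε n)) ^ q := Real.rpow_mul hl.le _ _
          _ ≤ _ := Real.rpow_le_rpow_of_nonpos hμn h8 hq.le
    calc lam n ^ t = lam n ^ (t - e) * lam n ^ e := by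
          rw [← Real.rpow_add hl, sub_add_cancel]
      _ ≤ (B ^ |t - e| * a ^ (t - e)) * μ.real (Metric.closedBall (x n) (lam n)) ^ q :=
          mul_le_mul (rpow_le_of_comparable ha0 (hlam n hn).1 (hlam n hn).2 hB1) h9
            (Real.rpow_nonneg hl.le _) (by positivity)
  have hmom := hsum g S (fun n hn => ⟨(hlam n hn).1, by
    have := (hlam n hn).2
    rw [hB] at this
    push_cast
    exact this⟩) hdisj
  calc ∑ n ∈ S, lam n ^ t
      ≤ ∑ n ∈ S, B ^ |t - e| * a ^ (t - e) * μ.real (Metric.closedBall (x n) (lam n)) ^ q :=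
        Finset.sum_le_sum hterm
    _ = B ^ |t - e| * a ^ (t - e) * ∑ n ∈ S, μ.real (Metric.closedBall (x n) (lam n)) ^ q :=
        (Finset.mul_sum _ _ _).symm
    _ ≤ B ^ |t - e| * a ^ (t - e) * (C * a ^ (α * q - β - κ)) := by
        refine mul_le_mul_of_nonneg_left (hmom.trans ?_) (by positivity)
        exact mul_le_mul_of_nonneg_left (hg₁ g hgg) hC.le
    _ = B ^ |t - e| * C * (a ^ (t - e) * a ^ (α * q - β - κ)) := by ring
    _ ≤ B ^ |t - e| * C * side 2 j ^ κ := by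
        refine mul_le_mul_of_nonneg_left ?_ (by positivity)
        rw [← Real.rpow_add ha0]
        calc a ^ (t - e + (α * q - β - κ)) ≤ a ^ κ := by
              refine Real.rpow_le_rpow_of_exponent_ge ha0 ha1 ?_
              rw [he]
              have : t - β = 3 * κ := by rw [hκ]; ring
              linarith
          _ ≤ side 2 j ^ κ := Real.rpow_le_rpow ha0.le (by linarith) hκ0.le

/-- For weakly redundant systems, the radii to a power greater than `τ_μ^*(α)` of the balls with
prescribed mass form a summable series. -/
lemma exists_summable_rpow [IsFiniteMeasure μ] (hc : 2 ≤ c) (hμ : μ (unitBox d)ᶜ = 0)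
    (hμpos : ∀ j k, IsIndex c j k → 0 < μ.real (box c j k))
    (hx : ∀ n, x n ∈ Icc (0 : Fin d → ℝ) 1) (hpos : ∀ n, 0 < lam n) (hanti : Antitone lam)
    (hlim : Tendsto lam atTop (𝓝 0)) (hred : IsWeaklyRedundant x lam)
    (hβ : (β : EReal) = tauStar c μ α) (hε : Tendsto ε atTop (𝓝 0)) {t : ℝ} (ht : β < t) :
    ∃ N₁ : ℕ, Summable fun n =>
      {n | N₁ ≤ n ∧ HasScaling μ x lam α ε n}.indicator (fun n => lam n ^ t) n := by
  classical
  obtain ⟨κ, C, hκ, hC, j₁, hj₁⟩ := exists_sum_disjoint_le hc hμ hμpos hx hpos hanti hβ hε ht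
  obtain ⟨R, hR, hT⟩ := hred
  have hlog2 : 0 < Real.log 2 := Real.log_pos (by norm_num)
  obtain ⟨j₂, hj₂⟩ := eventually_atTop.1
    (hR.eventually_lt_const (by positivity : 0 < κ / 2 * Real.log 2))
  set j₃ := max (max j₁ j₂) 1 with hj₃
  -- Half of the decay `2 ^ (-κ j)` compensates the number of disjoint families, which is at most `2
  -- ^ (κ j / 2)` for large `j`.
  set r : ℝ := side 2 1 ^ (κ / 2) with hr
  have hr0 : 0 < r := Real.rpow_pos_of_pos (side_pos le_rfl 1) _
  have hr1 : r < 1 := Real.rpow_lt_one (side_pos le_rfl 1).le (by norm_num [side]) (by positivity)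
  have hside : ∀ j : ℕ, side 2 j = Real.exp (-(j : ℝ) * Real.log 2) := by
    intro j
    rw [neg_mul, Real.exp_neg, Real.exp_nat_mul, Real.exp_log two_pos, side]
    norm_num
  have hclass : ∀ j, j₃ ≤ j → ∀ S : Finset ℕ,
      (∀ n ∈ S, n ∈ dyadicClass lam j ∧ HasScaling μ x lam α ε n) →
      ∑ n ∈ S, lam n ^ t ≤ C * r ^ j := by
    intro j hj S hS
    have hj1 : j₁ ≤ j := ((le_max_left _ _).trans (le_max_left _ _)).trans hj
    have hj2 : j₂ ≤ j := ((le_max_right _ _).trans (le_max_left _ _)).trans hj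
    have hjpos : 1 ≤ j := (le_max_right _ _).trans hj
    obtain ⟨T, hTun, -, hTdisj⟩ := hT j hjpos
    have hj0 : (0 : ℝ) < j := by exact_mod_cast hjpos
    have hN : (R j : ℝ) ≤ Real.exp (κ / 2 * Real.log 2 * j) := by
      rcases Nat.eq_zero_or_pos (R j) with h0 | h0
      · rw [h0, Nat.cast_zero]; exact (Real.exp_pos _).le
      · have h1 := (div_lt_iff₀ hj0).1 (hj₂ j hj2)
        have h2 : (0 : ℝ) < R j := by exact_mod_cast h0
        exact (Real.log_le_iff_le_exp h2).1 h1.le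
    have hcov : ∀ n ∈ S, ∃ i, n ∈ T i := fun n hn => by
      have h1 := (hS n hn).1
      rw [← hTun] at h1
      exact mem_iUnion.1 h1
    calc ∑ n ∈ S, lam n ^ t ≤ ∑ n ∈ S, ∑ i, if n ∈ T i then lam n ^ t else 0 := by
          refine Finset.sum_le_sum fun n hn => ?_
          obtain ⟨i, hi⟩ := hcov n hn
          have h1 := Finset.single_le_sum (f := fun i => if n ∈ T i then lam n ^ t else 0)
            (fun i _ => by
              split_ifs
              · exact Real.rpow_nonneg (hpos n).le _
              · exact le_rfl) (Finset.mem_univ i)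
          simpa only [if_pos hi] using h1
      _ = ∑ i, ∑ n ∈ S with n ∈ T i, lam n ^ t := by
          rw [Finset.sum_comm]
          exact Finset.sum_congr rfl fun i _ => (Finset.sum_filter _ _).symm
      _ ≤ ∑ _i : Fin (R j), C * side 2 j ^ κ := by
          refine Finset.sum_le_sum fun i _ => hj₁ j hj1 _ (fun n hn => ?_) fun n hn n' hn' hne => ?_
          · exact hS n (Finset.mem_filter.1 hn).1
          · exact hTdisj i n (Finset.mem_filter.1 hn).2 n' (Finset.mem_filter.1 hn').2 hne
      _ = R j * (C * side 2 j ^ κ) := by simp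
      _ ≤ Real.exp (κ / 2 * Real.log 2 * j) * (C * side 2 j ^ κ) :=
          mul_le_mul_of_nonneg_right hN
            (mul_nonneg hC.le (Real.rpow_nonneg (side_pos le_rfl j).le _))
      _ = C * r ^ j := by
          rw [hr, hside j, hside 1, ← Real.exp_mul, ← Real.exp_mul, ← Real.exp_nat_mul,
            mul_left_comm, ← Real.exp_add]
          congr 2
          push_cast
          ring
  obtain ⟨N₁, hN₁⟩ := eventually_atTop.1
    (hlim.eventually_lt_const (side_pos (le_refl 2) j₃))
  have hjf : ∀ n, ∃ j, N₁ ≤ n → j₃ ≤ j ∧ n ∈ dyadicClass lam j := by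
    intro n
    by_cases hn : N₁ ≤ n
    · have h1 := hN₁ n hn
      obtain ⟨j, h2, h3⟩ := exists_side_near (le_refl 2) (hpos n)
        (h1.le.trans (side_le_one le_rfl _))
      refine ⟨j, fun _ => ⟨?_, h2, h3⟩⟩
      by_contra hcon
      have := side_antitone (le_refl 2) (by omega : j + 1 ≤ j₃)
      linarith
    · exact ⟨0, fun h => (hn h).elim⟩
  choose jf hjf using hjf
  refine ⟨N₁, summable_of_sum_le (c := C * (1 - r)⁻¹) (fun n => ?_) fun S => ?_⟩
  · exact indicator_nonneg (fun n _ => Real.rpow_nonneg (hpos n).le _) n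
  · rw [Finset.sum_indicator_eq_sum_filter]
    set S' := S.filter fun n => n ∈ {n | N₁ ≤ n ∧ HasScaling μ x lam α ε n} with hS'
    have hS'mem : ∀ n ∈ S', N₁ ≤ n ∧ HasScaling μ x lam α ε n := fun n hn =>
      (Finset.mem_filter.1 hn).2
    rw [← Finset.sum_fiberwise_of_maps_to (t := S'.image jf) (g := jf)
      fun n hn => Finset.mem_image_of_mem jf hn]
    have hgeo := (hasSum_geometric_of_lt_one hr0.le hr1).mul_left C
    refine le_trans (Finset.sum_le_sum fun j hj => ?_)
      (sum_le_hasSum (S'.image jf) (fun j _ => by positivity) hgeo)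
    obtain ⟨n, hn, rfl⟩ := Finset.mem_image.1 hj
    refine hclass _ (hjf n (hS'mem n hn).1).1 _ fun n' hn' => ?_
    obtain ⟨h1, h2⟩ := Finset.mem_filter.1 hn'
    refine ⟨?_, (hS'mem n' h1).2⟩
    rw [← h2]
    exact (hjf n' (hS'mem n' h1).1).2

/-- The dimension of the conditioned limsup set is at most `τ_μ^*(α) / δ`. -/
theorem dimH_conditionedLimsup_le [IsFiniteMeasure μ] (hc : 2 ≤ c) (hμ : μ (unitBox d)ᶜ = 0)
    (hμpos : ∀ j k, IsIndex c j k → 0 < μ.real (box c j k))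
    (hx : ∀ n, x n ∈ Icc (0 : Fin d → ℝ) 1) (hpos : ∀ n, 0 < lam n) (hanti : Antitone lam)
    (hlim : Tendsto lam atTop (𝓝 0)) (hred : IsWeaklyRedundant x lam) (hβ0 : 0 < β)
    (hβ : (β : EReal) = tauStar c μ α) (hε : Tendsto ε atTop (𝓝 0)) {δ : ℝ} (hδ : 0 < δ) :
    dimH (conditionedLimsup μ x lam δ α ε) ≤ ENNReal.ofReal (β / δ) := by
  refine ENNReal.le_of_forall_pos_le_add fun e he _ => ?_
  set s : ℝ := β / δ + e with hs
  have he' : (0 : ℝ) < e := he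
  have hβδ : 0 < β / δ := div_pos hβ0 hδ
  have hs0 : 0 < s := by rw [hs]; linarith
  have hsum : ENNReal.ofReal (β / δ) + e = ((s.toNNReal : NNReal) : ENNReal) := by
    rw [← ENNReal.ofReal_coe_nnreal, ← ENNReal.ofReal_add hβδ.le he'.le]
    rfl
  rw [hsum]
  -- The exponent `δ * s` of `lam n` in the covering cost lies in the summable range.
  have ht : β < δ * s := by
    rw [hs, mul_add, mul_div_cancel₀ _ hδ.ne']
    linarith [mul_pos hδ he']
  obtain ⟨N₁, hN₁⟩ := exists_summable_rpow hc hμ hμpos hx hpos hanti hlim hred hβ hε ht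
  set Z : Set ℕ := {n | N₁ ≤ n ∧ HasScaling μ x lam α ε n} with hZ
  refine dimH_le_of_hausdorffMeasure_ne_top ?_
  rw [Real.coe_toNNReal s hs0.le]
  have htend : Tendsto (fun N => ENNReal.ofReal (2 * lam N ^ δ)) atTop (𝓝 0) := by
    have h1 : Tendsto (fun N => 2 * lam N ^ δ) atTop (𝓝 0) := by
      have h2 := (hlim.rpow_const (p := δ) (Or.inr hδ.le)).const_mul 2
      simpa [Real.zero_rpow hδ.ne'] using h2
    simpa using ENNReal.tendsto_ofReal h1
  -- The cover at stage `N` is indexed by all `n`; inadmissible indices give the empty set, of zero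
  -- cost since `s > 0`.
  set V : ℕ → ℕ → Set (Fin d → ℝ) := fun N n =>
    {y | N ≤ n ∧ HasScaling μ x lam α ε n ∧ y ∈ Metric.closedBall (x n) (lam n ^ δ)} with hV
  have hdiam : ∀ N n, Metric.ediam (V N n) ≤ ENNReal.ofReal (2 * lam n ^ δ) := by
    intro N n
    refine Metric.ediam_le_of_forall_dist_le fun y hy w hw => ?_
    have h1 := Metric.mem_closedBall.1 hy.2.2
    have h2 := Metric.mem_closedBall.1 hw.2.2
    linarith [dist_triangle_right y w (x n)]
  have hle := Measure.hausdorffMeasure_le_liminf_tsum s (conditionedLimsup μ x lam δ α ε)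
    (fun N => ENNReal.ofReal (2 * lam N ^ δ)) htend V
    (Eventually.of_forall fun N n => ?_) (Eventually.of_forall fun N y hy => ?_)
  · refine ne_top_of_le_ne_top (b := ENNReal.ofReal (2 ^ s) *
      ∑' n, ENNReal.ofReal (Z.indicator (fun n => lam n ^ (δ * s)) n)) ?_ (hle.trans ?_)
    · refine ENNReal.mul_ne_top ENNReal.ofReal_ne_top hN₁.tsum_ofReal_ne_top
    · refine (liminf_le_liminf (v := fun _ => ENNReal.ofReal (2 ^ s) *
        ∑' n, ENNReal.ofReal (Z.indicator (fun n => lam n ^ (δ * s)) n)) ?_).trans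
        (liminf_const _).le
      filter_upwards [eventually_ge_atTop N₁] with N hN
      rw [← ENNReal.tsum_mul_left]
      refine ENNReal.tsum_le_tsum fun n => ?_
      by_cases hn : N ≤ n ∧ HasScaling μ x lam α ε n
      · have hnZ : n ∈ Z := ⟨hN.trans hn.1, hn.2⟩
        have hl := hpos n
        refine (ENNReal.rpow_le_rpow (hdiam N n) hs0.le).trans (le_of_eq ?_)
        rw [indicator_of_mem hnZ, ENNReal.ofReal_rpow_of_nonneg (by positivity) hs0.le,
          Real.mul_rpow two_pos.le (by positivity), ← Real.rpow_mul hl.le,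
          ENNReal.ofReal_mul (by positivity)]
      · have hem : V N n = ∅ := by
          ext y
          simp only [hV, mem_ofPred_eq, mem_empty_iff_false, iff_false]
          exact fun h => hn ⟨h.1, h.2.1⟩
        rw [hem, Metric.ediam_empty, ENNReal.zero_rpow_of_pos hs0]
        exact bot_le
  · rcases le_or_gt N n with h | h
    · refine (hdiam N n).trans (ENNReal.ofReal_le_ofReal ?_)
      have := Real.rpow_le_rpow (hpos n).le (hanti h) hδ.le
      linarith
    · have hem : V N n = ∅ := by
        ext y
        simp only [hV, mem_ofPred_eq, mem_empty_iff_false, iff_false]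
        exact fun h' => absurd h'.1 (not_le.2 h)
      rw [hem, Metric.ediam_empty]
      exact bot_le
  · obtain ⟨n, h1, h2, h3, h4⟩ := hy N
    exact mem_iUnion.2 ⟨n, h1, ⟨h2, h3⟩, h4⟩

end UpperBoundDimension
end HetUbiquity

/-! ### Assembly of the two bounds. -/

theorem mainTheorem6 {d : ℕ} (b : ℕ) (hb : 2 ≤ b) (p : (Fin d → Fin b) → ℝ)
    (hp : ∀ e, 0 < p e) (hp_sum : ∑ e, p e = 1)
    (μ : MeasureTheory.Measure (Fin d → ℝ)) (hμ : μ = HetUbiquity.multinomialMeasure b p)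
    (x : ℕ → Fin d → ℝ) (hx : ∀ n, x n ∈ Set.Icc (0 : Fin d → ℝ) 1)
    (lam : ℕ → ℝ) (hlam_pos : ∀ n, 0 < lam n) (hlam_anti : Antitone lam)
    (hlam_lim : Filter.Tendsto lam Filter.atTop (nhds 0))
    (c : ℕ) (hc : 2 ≤ c) (α β : ℝ)
    (hβ : (β : EReal) = HetUbiquity.tauStar c μ α)
    (hred : HetUbiquity.IsWeaklyRedundant x lam)
    (D : Set ℝ) (hubi : HetUbiquity.IsHeterogeneousUbiquitous c μ α β x lam D)
    (hD : Set.Ioi 1 ⊆ closure D) :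
    ∃ ε : ℕ → ℝ, (∀ n, 0 < ε n) ∧ Filter.Tendsto ε Filter.atTop (nhds 0) ∧
      ∀ δ : ℝ, 1 ≤ δ →
        dimH (HetUbiquity.conditionedLimsup μ x lam δ α ε) = ENNReal.ofReal (β / δ) := by
  obtain ⟨φ, ψ, m, mL, H⟩ := hubi
  have hfin : IsFiniteMeasure μ := hμ ▸ HetUbiquity.isFiniteMeasure_multinomialMeasure hp hp_sum
  have hμ0 : μ (HetUbiquity.unitBox d)ᶜ = 0 :=
    hμ ▸ HetUbiquity.multinomialMeasure_compl_unitBox hb hp hp_sum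
  obtain ⟨ε, hε, hεlim, hP⟩ := HetUbiquity.exists_scaling_errors hc H.gauges hμ0 H.alpha_pos
    H.scaling x hlam_pos hlam_lim
  refine ⟨ε, hε, hεlim, fun δ hδ => le_antisymm ?_ ?_⟩
  · exact HetUbiquity.dimH_conditionedLimsup_le hc hμ0 (fun j k hk => H.measureReal_box_pos hc hk)
      hx hlam_pos hlam_anti hlam_lim hred H.beta_pos hβ hεlim (one_pos.trans_le hδ)
  · refine (H.le_dimH hc hD hx hlam_pos hlam_anti
      (P := HetUbiquity.HasScaling μ x lam α ε) hP hδ).trans (dimH_mono fun y hy N => ?_)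
    obtain ⟨n, h1, ⟨h2, h3⟩, h4⟩ := hy N
    exact ⟨n, h1, h2, h3, h4⟩
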